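/- Let $A^3=\mathbb R^3$. For $I=(I_{40},I_{31},I_{22},I_{13},I_{04})\in\mathbb R^5$ put $$q_I(x,y)=I_{40}x^4+4I_{31}x^3y+6I_{22}x^2y^2+4I_{13}xy^3+I_{04}y^4 .$$ Let $S\subset A^3$. A basis $e=(e_1,e_2,e_3)$ of $\mathbb R^3$ is a *normalizing frame* of $S$ at $p\in S$ *with curvatures* $I$ if, in the affine coordinates $(x,y,z)$ with origin $p$ and basis $e$, the set $S$ coincides near $p$ with the graph $z=u(x,y)$ of a $C^\infty$ function $u$ with $$u(x,y)=\tfrac12(x^2+y^2)+\tfrac16(x^3-3xy^2)+\tfrac1{24}q_I(x,y)+o\big(|(x,y)|^4\big).$$ $S$ is a *regular elliptical surface* if it has a normalizing frame at each of its points. Let $T_pS$ be the tangent plane. The *coframe* of a normalizing frame $e$ at $p$ is the pair $(w_1,w_2)$ of linear forms on $T_pS$ with $v=w_1(v)e_1+w_2(v)e_2$ for $v\in T_pS$. The second, third and fourth fundamental forms of $S$ at $p$ are the functions on $T_pS$ $$\Phi_2=w_1^2+w_2^2,\qquad \Phi_3=w_1^3-3w_1w_2^2,\qquad \Phi_4=q_I(w_1,w_2),$$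 computed with any one normalizing frame at $p$ and its curvatures $I$ (by part 1 below the choice does not matter). Let $D_3\subset O(2)$ be the symmetry group of the equilateral triangle with vertices $(1,0)$, $(-\frac12,\pm\frac{\sqrt3}{2})$. **Theorem 4.3.** Let $S$ be a regular elliptical surface. Then $\Phi_2,\Phi_3,\Phi_4$ are complete affine invariants of $S$. That is: 1. Let $p\in S$ and let $e$ be any normalizing frame at $p$, with curvatures $I$ and coframe $(w_1,w_2)$. Then $T_pS$ is spanned by $e_1,e_2$, and $w_1^2+w_2^2=\Phi_2$, $w_1^3-3w_1w_2^2=\Phi_3$. For a pair $(\alpha_1,\alpha_2)$ of linear forms on $T_pS$ the following are equivalent: (a) $\alpha_1^2+\alpha_2^2=\Phi_2$ and $\alpha_1^3-3\alpha_1\alpha_2^2=\Phi_3$; (b) $(\alpha_1,\alpha_2)$ is the image of $(w_1,w_2)$ under an element of $D_3$; (c) $(\alpha_1,\alpha_2)$ is the coframe of some normalizing frame at $p$. Moreover, for $J\in\mathbb R^5$, $\Phi_4=q_J(w_1,w_2)$ holds on $T_pS$ if and only if $J=I$. 2. (Invariance.) For every affine automorphism $A$ of $A^3$ the image $A(S)$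 is a regular elliptical surface. If $S'$ is a regular elliptical surface and $f:S\to S'$ is a smooth map that is the restriction to $S$ of an affine automorphism of $A^3$, then $f^*\Phi_k'=\Phi_k$ for $k=2,3,4$, where $\Phi'_k$ are the fundamental forms of $S'$. 3. (Completeness.) If $S$ is connected, $S'$ is a regular elliptical surface and $f:S\to S'$ is a smooth map with $f^*\Phi'_k=\Phi_k$ for $k=2,3,4$, then $f$ is the restriction to $S$ of an affine automorphism of $A^3$. -/

import Mathlib

open Set Filter Topology Asymptotics
open scoped ContDiff

noncomputable section

namespace AffineSurface

/-- The affine space `A³` with its affine coordinates. -/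
abbrev A3 : Type := Fin 3 → ℝ

/-- The binary quartic `I₄₀ x⁴ + 4 I₃₁ x³ y + 6 I₂₂ x² y² + 4 I₁₃ x y³ + I₀₄ y⁴`, whose
coefficients are listed as `I = (I₄₀, I₃₁, I₂₂, I₁₃, I₀₄)`. -/
def quartic (I : Fin 5 → ℝ) (x y : ℝ) : ℝ :=
  I 0 * x ^ 4 + 4 * I 1 * x ^ 3 * y + 6 * I 2 * x ^ 2 * y ^ 2 + 4 * I 3 * x * y ^ 3 + I 4 * y ^ 4

/-- The standard form of a regular elliptical `4`-jet at the origin. -/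
def standardJet (I : Fin 5 → ℝ) (x y : ℝ) : ℝ :=
  (1 / 2) * (x ^ 2 + y ^ 2) + (1 / 6) * (x ^ 3 - 3 * x * y ^ 2) + (1 / 24) * quartic I x y

/-- In the affine coordinates `(x, y, z)` with origin `p` and basis `e = (e₁, e₂, e₃)`, the set `S`
is near `p` the graph `z = u (x, y)` of a smooth function `u` whose `4`-jet at `0` is the standard
form with fourth order coefficients `I`.  Equivalently, the affine transformation whose columns are
`e₁, e₂, e₃, p` brings the jet of `S` at `p` to the standard form. -/
def IsNormalForm (S : Set A3) (p : A3) (e : Module.Basis (Fin 3) ℝ A3) (I : Fin 5 → ℝ) : Prop :=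
  ∃ u : ℝ × ℝ → ℝ,
    (∃ U ∈ 𝓝 (0 : ℝ × ℝ), ContDiffOn ℝ ∞ u U) ∧
    (∀ᶠ q in 𝓝 p,
      (q ∈ S ↔ e.coord 2 (q - p) = u (e.coord 0 (q - p), e.coord 1 (q - p)))) ∧
    (fun t : ℝ × ℝ => u t - standardJet I t.1 t.2) =o[𝓝 0] (fun t : ℝ × ℝ => ‖t‖ ^ 4)

/-- A regular elliptical surface: a smooth (embedded) surface in `A³` whose jet at every point can
be transformed by an affine transformation to the regular elliptical standard form. -/
def IsRegularElliptical (S : Set A3) : Prop :=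
  ∀ p ∈ S, ∃ (e : Module.Basis (Fin 3) ℝ A3) (I : Fin 5 → ℝ), IsNormalForm S p e I

/-- The tangent plane of `S` at `p`. -/
def tangentPlane (S : Set A3) (p : A3) : Submodule ℝ A3 :=
  Submodule.span ℝ (tangentConeAt ℝ S p)

/-- The coframe `(w₁, w₂)` on the tangent plane that belongs to the frame `e = (e₁, e₂, e₃)`: on
tangent vectors `v = w₁ e₁ + w₂ e₂`. -/
def coframe (S : Set A3) (p : A3) (e : Module.Basis (Fin 3) ℝ A3) :
    Fin 2 → Module.Dual ℝ (tangentPlane S p) :=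
  ![(e.coord 0).domRestrict (tangentPlane S p), (e.coord 1).domRestrict (tangentPlane S p)]

namespace IsRegularElliptical

variable {S : Set A3}

/-- A frame that brings the jet of `S` at `p` to standard form. -/
def frame (hS : IsRegularElliptical S) (p : S) : Module.Basis (Fin 3) ℝ A3 :=
  (hS p p.2).choose

/-- The curvatures `(I₄₀, I₃₁, I₂₂, I₁₃, I₀₄)` of `S` at `p` with respect to `hS.frame p`. -/
def curvature (hS : IsRegularElliptical S) (p : S) : Fin 5 → ℝ :=
  (hS p p.2).choose_spec.choose

/-- The second fundamental form `Φ₂ = w₁² + w₂²`. -/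
def form2 (hS : IsRegularElliptical S) (p : S) (v : tangentPlane S p) : ℝ :=
  coframe S p (hS.frame p) 0 v ^ 2 + coframe S p (hS.frame p) 1 v ^ 2

/-- The third fundamental form `Φ₃ = w₁³ - 3 w₁ w₂²`. -/
def form3 (hS : IsRegularElliptical S) (p : S) (v : tangentPlane S p) : ℝ :=
  coframe S p (hS.frame p) 0 v ^ 3
    - 3 * coframe S p (hS.frame p) 0 v * coframe S p (hS.frame p) 1 v ^ 2

/-- The fourth fundamental form
`Φ₄ = I₄₀ w₁⁴ + 4 I₃₁ w₁³ w₂ + 6 I₂₂ w₁² w₂² + 4 I₁₃ w₁ w₂³ + I₀₄ w₂⁴`. -/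
def form4 (hS : IsRegularElliptical S) (p : S) (v : tangentPlane S p) : ℝ :=
  quartic (hS.curvature p) (coframe S p (hS.frame p) 0 v) (coframe S p (hS.frame p) 1 v)

end IsRegularElliptical

/-- The rotation by `2π/3`. -/
def sigma : Matrix (Fin 2) (Fin 2) ℝ :=
  !![-1 / 2, -(Real.sqrt 3 / 2); Real.sqrt 3 / 2, -1 / 2]

/-- The reflection that changes the sign of the second coordinate. -/
def tau : Matrix (Fin 2) (Fin 2) ℝ :=
  !![1, 0; 0, -1]

/-- The symmetry group `D₃` of the equilateral triangle with vertices
`(1, 0), (-1/2, √3/2), (-1/2, -√3/2)`, as the set of its six matrices. -/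
def D3 : Set (Matrix (Fin 2) (Fin 2) ℝ) :=
  {M | ∃ k < 3, ∃ l < 2, M = sigma ^ (k : ℕ) * tau ^ (l : ℕ)}

/-- The differential at `p` of a smooth map `f : S → S'`, from the tangent plane of `S` at `p` to
the tangent plane of `S'` at `f p`. -/
def differential {S S' : Set A3} {f : A3 → A3} (hf : ContDiffOn ℝ ∞ f S) (hm : MapsTo f S S')
    (p : S) : tangentPlane S p →ₗ[ℝ] tangentPlane S' (f p) :=
  (fderivWithin ℝ f S p).toLinearMap.restrict (by
    have hd : HasFDerivWithinAt f (fderivWithin ℝ f S p) S p :=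
      ((hf.differentiableOn (by simp)) p p.2).hasFDerivWithinAt
    have hle : tangentPlane S p ≤
        (tangentPlane S' (f p)).comap (fderivWithin ℝ f S p).toLinearMap :=
      Submodule.span_le.2 fun v hv => Submodule.subset_span
        (tangentConeAt_mono hm.image_subset (hd.mapsTo_tangent_cone hv))
    exact fun v hv => hle hv)

/-- The smooth map `f : S → S'` pulls the second, third and fourth fundamental forms of `S'` back to
those of `S`. -/
def PreservesForms {S S' : Set A3} (hS : IsRegularElliptical S) (hS' : IsRegularElliptical S')
    {f : A3 → A3} (hf : ContDiffOn ℝ ∞ f S) (hm : MapsTo f S S') : Prop :=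
  ∀ (p : S) (v : tangentPlane S p),
    hS'.form2 ⟨f p, hm p.2⟩ (differential hf hm p v) = hS.form2 p v ∧
    hS'.form3 ⟨f p, hm p.2⟩ (differential hf hm p v) = hS.form3 p v ∧
    hS'.form4 ⟨f p, hm p.2⟩ (differential hf hm p v) = hS.form4 p v

/-- The pair `α` of linear forms on the tangent plane solves `α₁² + α₂² = Φ₂` and
`α₁³ - 3 α₁ α₂² = Φ₃`. -/
def SolvesForms {S : Set A3} (hS : IsRegularElliptical S) (p : S)
    (α : Fin 2 → Module.Dual ℝ (tangentPlane S p)) : Prop :=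
  ∀ v : tangentPlane S p,
    α 0 v ^ 2 + α 1 v ^ 2 = hS.form2 p v ∧
    α 0 v ^ 3 - 3 * α 0 v * α 1 v ^ 2 = hS.form3 p v

end AffineSurface

end

open AffineSurface

noncomputable section

/-! Pointwise part. Write the surface as a graph with quadratic part Q and cubic part K. If L is the
tangential part of the change to a normalizing frame and (m, c) are the tangential and transversal
components of the old transversal vector in that frame, then c Q = |L|² and c K = 3⟨L, m⟩ Q + (L₁³ -
3 L₁ L₂²). The standard cubic is harmonic, so the trace of K with respect to Q determines m; its
Hessian is a multiple of x² + y², which determines c. Thus the third vector of a normalizing frame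
and the form Φ₂ = c Q are rational in the 3-jet (`shift_and_scale_eq`, `frame_relation`). The
remaining freedom preserves x² + y² and x³ - 3xy², and is therefore `D3` (`mem_D3_iff`). Two
normalizing frames at one point share their third vector, and then the terms of orders two, three
and four agree as forms on the tangent plane (`IsNormalForm.forms_eq`). Invariance follows, because
affine maps carry normalizing frames to normalizing frames with the same curvatures.

Completeness. If f preserves the forms, the coframe at f p pulls back to the coframe of a
normalizing frame at p, and Φ₄ forces equal curvatures (`exists_isMatched`). Let L_p be the linear
map between the two matched frames; it extends the differential of f. The claim is that L_p is
locally constant. In the matched coordinates at p both surfaces are graphs, of u and u', with the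
same 4-jet, so all derivatives up to order three agree to first order. The map f becomes a planar
map φ with dφ(0) = id that is an isometry for the metrics Φ₂. These metrics agree to first order,
hence d²φ(0) = 0, by the argument that proves uniqueness of the Levi-Civita connection. For q near
p, L_q is an expression in dφ and the 3-jets of u and u', so its derivative at p vanishes
(`hasFDerivWithinAt_frameMap`). This expression does not involve the frames chosen at q, so they may
be chosen pointwise without any continuity. Now L and then f - L are locally constant, and
connectedness gives one affine map. -/

namespace AffineSurface

/-! ### Comparison of Taylor coefficients along curves -/

/-- A function of the form `a₁ t + a₂ t² + a₃ t³ + B(t) t⁴` with `B(t) → a₄` vanishes near `0` only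
if all `aᵢ` do. -/
theorem coeff_eq_zero {a₁ a₂ a₃ a₄ : ℝ} {B : ℝ → ℝ} (hB : Tendsto B (𝓝[≠] 0) (𝓝 a₄))
    (h : ∀ᶠ t in 𝓝[≠] (0 : ℝ), a₁ * t + a₂ * t ^ 2 + a₃ * t ^ 3 + B t * t ^ 4 = 0) :
    a₁ = 0 ∧ a₂ = 0 ∧ a₃ = 0 ∧ a₄ = 0 := by
  have ht : Tendsto (fun t : ℝ => t) (𝓝[≠] 0) (𝓝 0) := tendsto_id.mono_left nhdsWithin_le_nhds
  have hne : ∀ᶠ t in 𝓝[≠] (0 : ℝ), t ≠ 0 := eventually_mem_nhdsWithin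
  -- Letting t → 0 isolates the lowest coefficient. After division by the next power of t, the same
  -- limit gives the following one.
  have key : ∀ (a : ℝ) (F : ℝ → ℝ) (b : ℝ), Tendsto F (𝓝[≠] 0) (𝓝 b) →
      (∀ᶠ t in 𝓝[≠] (0 : ℝ), a + F t * t = 0) → a = 0 := by
    intro a F b hF h0
    have h1 : Tendsto (fun t => a + F t * t) (𝓝[≠] 0) (𝓝 (a + b * 0)) :=
      tendsto_const_nhds.add (hF.mul ht)
    have h2 : Tendsto (fun t => a + F t * t) (𝓝[≠] 0) (𝓝 0) :=
      tendsto_const_nhds.congr' (h0.mono fun t h => h.symm)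
    simpa using tendsto_nhds_unique h1 h2
  have h1 : a₁ = 0 := by
    refine key a₁ (fun t => a₂ + a₃ * t + B t * t ^ 2) (a₂ + a₃ * 0 + a₄ * 0 ^ 2)
      ((tendsto_const_nhds.add (tendsto_const_nhds.mul ht)).add (hB.mul (ht.pow 2))) ?_
    filter_upwards [h, hne] with t h hne
    exact mul_right_cancel₀ hne (by linear_combination h)
  have h2 : a₂ = 0 := by
    refine key a₂ (fun t => a₃ + B t * t) (a₃ + a₄ * 0)
      (tendsto_const_nhds.add (hB.mul ht)) ?_
    filter_upwards [h, hne] with t h hne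
    exact mul_right_cancel₀ (pow_ne_zero 2 hne) (by linear_combination h - t * h1)
  have h3 : a₃ = 0 := by
    refine key a₃ B a₄ hB ?_
    filter_upwards [h, hne] with t h hne
    exact mul_right_cancel₀ (pow_ne_zero 3 hne) (by linear_combination h - t * h1 - t ^ 2 * h2)
  refine ⟨h1, h2, h3, ?_⟩
  have h4 : Tendsto B (𝓝[≠] 0) (𝓝 0) := by
    refine tendsto_const_nhds.congr' ?_
    filter_upwards [h, hne] with t h hne
    exact mul_right_cancel₀ (pow_ne_zero 4 hne)
      (by linear_combination -h + t * h1 + t ^ 2 * h2 + t ^ 3 * h3)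
  exact tendsto_nhds_unique hB h4

theorem isBigO_pow_id {k : ℕ} (hk : 1 ≤ k) :
    (fun t : ℝ => t ^ k) =O[𝓝 0] (fun t : ℝ => t) := by
  refine IsBigO.of_bound 1 ?_
  filter_upwards [Metric.ball_mem_nhds (0 : ℝ) one_pos] with t ht
  have h1 : |t| ≤ 1 := by simpa using (Metric.mem_ball.1 ht).le
  simpa using pow_le_of_le_one (abs_nonneg t) h1 (by omega : k ≠ 0)

theorem tendsto_quartic {l : Filter ℝ} (I : Fin 5 → ℝ) {f g : ℝ → ℝ} {a b : ℝ}
    (hf : Tendsto f l (𝓝 a)) (hg : Tendsto g l (𝓝 b)) :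
    Tendsto (fun t => quartic I (f t) (g t)) l (𝓝 (quartic I a b)) := by
  unfold quartic
  exact (((((hf.pow 4).const_mul _).add (((hf.pow 3).const_mul _).mul hg)).add
    (((hf.pow 2).const_mul _).mul (hg.pow 2))).add ((hf.const_mul _).mul (hg.pow 3))).add
    ((hg.pow 4).const_mul _)

/-- Comparison of the jets along a curve `t ↦ (l₁ t + m₁ w, l₂ t + m₂ w, l₃ t + c w)`,
`w = w₂ t² + w₃ t³ + w₄ t⁴ + o(t⁴)`, that lies on a surface in standard form. -/
theorem jet_comparison {u : ℝ × ℝ → ℝ} {I : Fin 5 → ℝ}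
    (hu : (fun t : ℝ × ℝ => u t - standardJet I t.1 t.2) =o[𝓝 0] (fun t : ℝ × ℝ => ‖t‖ ^ 4))
    {w : ℝ → ℝ} {w₂ w₃ w₄ : ℝ}
    (hw : (fun t => w t - (w₂ * t ^ 2 + w₃ * t ^ 3 + w₄ * t ^ 4)) =o[𝓝 0] (fun t : ℝ => t ^ 4))
    {l₁ l₂ l₃ m₁ m₂ c : ℝ}
    (h : ∀ᶠ t in 𝓝 (0 : ℝ), l₃ * t + c * w t = u (l₁ * t + m₁ * w t, l₂ * t + m₂ * w t)) :
    l₃ = 0 ∧ c * w₂ = (l₁ ^ 2 + l₂ ^ 2) / 2 ∧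
    c * w₃ = (l₁ * m₁ + l₂ * m₂) * w₂ + (l₁ ^ 3 - 3 * l₁ * l₂ ^ 2) / 6 ∧
    c * w₄ = (l₁ * m₁ + l₂ * m₂) * w₃ + (m₁ ^ 2 + m₂ ^ 2) * w₂ ^ 2 / 2
      + (l₁ ^ 2 * m₁ - l₂ ^ 2 * m₁ - 2 * l₁ * l₂ * m₂) * w₂ / 2 + quartic I l₁ l₂ / 24 := by
  have hwO : w =O[𝓝 0] (fun t : ℝ => t) := by
    have h1 : (fun t : ℝ => w₂ * t ^ 2 + w₃ * t ^ 3 + w₄ * t ^ 4) =O[𝓝 0] (fun t : ℝ => t) :=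
      (((isBigO_pow_id (by norm_num)).const_mul_left _).add
        ((isBigO_pow_id (by norm_num)).const_mul_left _)).add
        ((isBigO_pow_id (by norm_num)).const_mul_left _)
    simpa using (hw.isBigO.trans (isBigO_pow_id (by norm_num))).add h1
  have hxO : ∀ l m : ℝ, (fun t => l * t + m * w t) =O[𝓝 0] (fun t : ℝ => t) := fun l m =>
    ((isBigO_refl _ _).const_mul_left l).add (hwO.const_mul_left m)
  have hxy : (fun t => (l₁ * t + m₁ * w t, l₂ * t + m₂ * w t)) =O[𝓝 0] (fun t : ℝ => t) :=
    (hxO l₁ m₁).prod_left (hxO l₂ m₂)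
  have hη := ((hu.comp_tendsto (hxy.trans_tendsto tendsto_id)).trans_isBigO
    (hxy.norm_left.pow 4)).tendsto_div_nhds_zero.mono_left (nhdsWithin_le_nhds (s := {0}ᶜ))
  have hδ := hw.tendsto_div_nhds_zero.mono_left (nhdsWithin_le_nhds (s := {0}ᶜ))
  have ht : Tendsto (fun t : ℝ => t) (𝓝[≠] 0) (𝓝 0) := tendsto_id.mono_left nhdsWithin_le_nhds
  have hne : ∀ᶠ t in 𝓝[≠] (0 : ℝ), t ≠ 0 := eventually_mem_nhdsWithin
  set δ : ℝ → ℝ := fun t => (w t - (w₂ * t ^ 2 + w₃ * t ^ 3 + w₄ * t ^ 4)) / t ^ 4 with hδdef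
  set η : ℝ → ℝ := fun t => (u (l₁ * t + m₁ * w t, l₂ * t + m₂ * w t)
    - standardJet I (l₁ * t + m₁ * w t) (l₂ * t + m₂ * w t)) / t ^ 4 with hηdef
  change Tendsto η _ _ at hη
  -- Horner form of w: w = t² W0, W0 = w₂ + t W1, W1 = w₃ + t W2. Each factor has a limit, so the
  -- substitution into the standard jet remains a polynomial identity.
  obtain ⟨W2, hW2d⟩ : ∃ W : ℝ → ℝ, W = fun t => w₄ + δ t := ⟨_, rfl⟩
  obtain ⟨W1, hW1d⟩ : ∃ W : ℝ → ℝ, W = fun t => w₃ + t * W2 t := ⟨_, rfl⟩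
  obtain ⟨W0, hW0d⟩ : ∃ W : ℝ → ℝ, W = fun t => w₂ + t * W1 t := ⟨_, rfl⟩
  have hW2 : Tendsto W2 (𝓝[≠] 0) (𝓝 w₄) := by
    rw [hW2d]; simpa using tendsto_const_nhds.add hδ
  have hW1 : Tendsto W1 (𝓝[≠] 0) (𝓝 w₃) := by
    rw [hW1d]; simpa using tendsto_const_nhds.add (ht.mul hW2)
  have hW0 : Tendsto W0 (𝓝[≠] 0) (𝓝 w₂) := by
    rw [hW0d]; simpa using tendsto_const_nhds.add (ht.mul hW1)
  have hL : ∀ l m : ℝ, Tendsto (fun t => l + m * (t * W0 t)) (𝓝[≠] 0) (𝓝 l) := fun l m => by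
    simpa using tendsto_const_nhds.add (tendsto_const_nhds.mul (ht.mul hW0))
  -- This is everything of order at least four in the difference of the two sides, divided by t⁴.
  -- Its limit is the coefficient of t⁴.
  have hB : Tendsto (fun t => c * W2 t - (l₁ * m₁ + l₂ * m₂) * W1 t
      - (m₁ ^ 2 + m₂ ^ 2) * W0 t ^ 2 / 2
      - (3 * W0 t * (l₁ ^ 2 * m₁ - l₂ ^ 2 * m₁ - 2 * l₁ * l₂ * m₂)
        + 3 * t * W0 t ^ 2 * (m₁ ^ 2 * l₁ - m₂ ^ 2 * l₁ - 2 * m₁ * m₂ * l₂)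
        + t ^ 2 * W0 t ^ 3 * (m₁ ^ 3 - 3 * m₁ * m₂ ^ 2)) / 6
      - quartic I (l₁ + m₁ * (t * W0 t)) (l₂ + m₂ * (t * W0 t)) / 24 - η t) (𝓝[≠] 0)
      (𝓝 (c * w₄ - (l₁ * m₁ + l₂ * m₂) * w₃ - (m₁ ^ 2 + m₂ ^ 2) * w₂ ^ 2 / 2
      - (3 * w₂ * (l₁ ^ 2 * m₁ - l₂ ^ 2 * m₁ - 2 * l₁ * l₂ * m₂)
        + 3 * 0 * w₂ ^ 2 * (m₁ ^ 2 * l₁ - m₂ ^ 2 * l₁ - 2 * m₁ * m₂ * l₂)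
        + 0 ^ 2 * w₂ ^ 3 * (m₁ ^ 3 - 3 * m₁ * m₂ ^ 2)) / 6
      - quartic I l₁ l₂ / 24 - 0)) := by
    refine ((((((hW2.const_mul c).sub (hW1.const_mul _)).sub
      (((hW0.pow 2).const_mul _).div_const 2)).sub ?_).sub
      ((tendsto_quartic I (hL l₁ m₁) (hL l₂ m₂)).div_const 24)).sub hη)
    exact (((((hW0.const_mul 3).mul_const _).add
      (((ht.const_mul 3).mul (hW0.pow 2)).mul_const _)).add
      (((ht.pow 2).mul (hW0.pow 3)).mul_const _)).div_const 6)
  obtain ⟨e1, e2, e3, e4⟩ := coeff_eq_zero (a₁ := l₃) (a₂ := c * w₂ - (l₁ ^ 2 + l₂ ^ 2) / 2)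
    (a₃ := c * w₃ - (l₁ * m₁ + l₂ * m₂) * w₂ - (l₁ ^ 3 - 3 * l₁ * l₂ ^ 2) / 6) hB (by
      filter_upwards [nhdsWithin_le_nhds h, hne] with t h hne
      have hw' : w t = t ^ 2 * W0 t := by
        rw [hW0d, hW1d, hW2d]; simp only [hδdef]; field_simp; ring
      have hη' : η t * t ^ 4 = u (l₁ * t + m₁ * w t, l₂ * t + m₂ * w t)
          - standardJet I (l₁ * t + m₁ * w t) (l₂ * t + m₂ * w t) := by
        simp only [hηdef]; field_simp
      have h1 : W0 t = w₂ + t * W1 t := by rw [hW0d]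
      have h2 : W1 t = w₃ + t * W2 t := by rw [hW1d]
      rw [← h, hw'] at hη'
      have hj : standardJet I (l₁ * t + m₁ * (t ^ 2 * W0 t)) (l₂ * t + m₂ * (t ^ 2 * W0 t))
          = t ^ 2 * ((l₁ ^ 2 + l₂ ^ 2) / 2 + (l₁ * m₁ + l₂ * m₂) * (t * W0 t)
            + (m₁ ^ 2 + m₂ ^ 2) * (t * W0 t) ^ 2 / 2)
          + t ^ 3 * ((l₁ + m₁ * (t * W0 t)) ^ 3
            - 3 * (l₁ + m₁ * (t * W0 t)) * (l₂ + m₂ * (t * W0 t)) ^ 2) / 6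
          + t ^ 4 * quartic I (l₁ + m₁ * (t * W0 t)) (l₂ + m₂ * (t * W0 t)) / 24 := by
        unfold standardJet quartic; ring
      rw [hj] at hη'
      linear_combination -hη' + (c * t ^ 2 - (l₁ * m₁ + l₂ * m₂) * t ^ 3) * (-h1)
        - c * t ^ 3 * h2)
  refine ⟨e1, by linear_combination e2, by linear_combination e3, by linear_combination e4⟩

/-! ### The normalization of a cubic jet

A vector `j = (r, s, t, k₀, k₁, k₂, k₃)` stands for the jet
`(r a² + 2 s a b + t b²) / 2 + (k₀ a³ + 3 k₁ a² b + 3 k₂ a b² + k₃ b³) / 6`. -/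

/-- The quadratic form of a jet. -/
def jetQuadratic (j : Fin 7 → ℝ) (a b : ℝ) : ℝ := j 0 * a ^ 2 + 2 * j 1 * a * b + j 2 * b ^ 2

/-- The cubic form of a jet. -/
def jetCubic (j : Fin 7 → ℝ) (a b : ℝ) : ℝ :=
  j 3 * a ^ 3 + 3 * j 4 * a ^ 2 * b + 3 * j 5 * a * b ^ 2 + j 6 * b ^ 3

/-- The discriminant of the quadratic form. -/
def jetDisc (j : Fin 7 → ℝ) : ℝ := j 0 * j 2 - j 1 ^ 2

/-- First component of the trace of the cubic form, divided by `4`. -/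
def jetTrace₁ (j : Fin 7 → ℝ) : ℝ := (j 2 * j 3 - 2 * j 1 * j 4 + j 0 * j 5) / (4 * jetDisc j)

/-- Second component of the trace of the cubic form, divided by `4`. -/
def jetTrace₂ (j : Fin 7 → ℝ) : ℝ := (j 2 * j 4 - 2 * j 1 * j 5 + j 0 * j 6) / (4 * jetDisc j)

/-- First component of the tangential part of the transversal vector. -/
def jetShift₁ (j : Fin 7 → ℝ) : ℝ := (j 2 * jetTrace₁ j - j 1 * jetTrace₂ j) / jetDisc j

/-- Second component of the tangential part of the transversal vector. -/
def jetShift₂ (j : Fin 7 → ℝ) : ℝ := (j 0 * jetTrace₂ j - j 1 * jetTrace₁ j) / jetDisc j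

/-- The factor between the quadratic form of the jet and the second fundamental form. -/
def jetScale (j : Fin 7 → ℝ) : ℝ :=
  ((j 4 - (2 * jetTrace₁ j * j 1 + jetTrace₂ j * j 0)) ^ 2
    - (j 3 - 3 * jetTrace₁ j * j 0) * (j 5 - (jetTrace₁ j * j 2 + 2 * jetTrace₂ j * j 1)))
    / (jetDisc j * j 0)

theorem coeff_eq_of_quadratic_eq {a b c a' b' c' : ℝ}
    (h : ∀ x y : ℝ, a * x ^ 2 + b * x * y + c * y ^ 2 = a' * x ^ 2 + b' * x * y + c' * y ^ 2) :
    a = a' ∧ b = b' ∧ c = c' := by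
  have h1 := h 1 0
  have h2 := h 0 1
  have h3 := h 1 1
  refine ⟨?_, ?_, ?_⟩ <;> linarith

theorem coeff_eq_of_cubic_eq {a b c d a' b' c' d' : ℝ}
    (h : ∀ x y : ℝ, a * x ^ 3 + b * x ^ 2 * y + c * x * y ^ 2 + d * y ^ 3
      = a' * x ^ 3 + b' * x ^ 2 * y + c' * x * y ^ 2 + d' * y ^ 3) :
    a = a' ∧ b = b' ∧ c = c' ∧ d = d' := by
  have h1 := h 1 0
  have h2 := h 0 1
  have h3 := h 1 1
  have h4 := h 1 (-1)
  refine ⟨?_, ?_, ?_, ?_⟩ <;> linarith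

theorem quartic_injective {I J : Fin 5 → ℝ} (h : ∀ x y, quartic I x y = quartic J x y) :
    I = J := by
  have h1 := h 1 0
  have h2 := h 0 1
  have h3 := h 1 1
  have h4 := h 1 (-1)
  have h5 := h 1 2
  simp only [quartic] at h1 h2 h3 h4 h5
  funext i
  fin_cases i <;> simp <;> linarith

theorem exists_quartic_comp (I : Fin 5 → ℝ) (a b c d : ℝ) :
    ∃ J : Fin 5 → ℝ, ∀ x y, quartic J x y = quartic I (a * x + b * y) (c * x + d * y) := by
  refine ⟨![I 0 * a ^ 4 + 4 * I 1 * a ^ 3 * c + 6 * I 2 * a ^ 2 * c ^ 2 + 4 * I 3 * a * c ^ 3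
      + I 4 * c ^ 4,
    I 0 * a ^ 3 * b + I 1 * (a ^ 3 * d + 3 * a ^ 2 * b * c)
      + I 2 * (3 * a ^ 2 * c * d + 3 * a * b * c ^ 2) + I 3 * (3 * a * c ^ 2 * d + b * c ^ 3)
      + I 4 * c ^ 3 * d,
    I 0 * a ^ 2 * b ^ 2 + I 1 * (2 * a ^ 2 * b * d + 2 * a * b ^ 2 * c)
      + I 2 * (a ^ 2 * d ^ 2 + 4 * a * b * c * d + b ^ 2 * c ^ 2)
      + I 3 * (2 * a * c * d ^ 2 + 2 * b * c ^ 2 * d) + I 4 * c ^ 2 * d ^ 2,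
    I 0 * a * b ^ 3 + I 1 * (b ^ 3 * c + 3 * a * b ^ 2 * d)
      + I 2 * (3 * b ^ 2 * c * d + 3 * a * b * d ^ 2) + I 3 * (3 * b * c * d ^ 2 + a * d ^ 3)
      + I 4 * c * d ^ 3,
    I 0 * b ^ 4 + 4 * I 1 * b ^ 3 * d + 6 * I 2 * b ^ 2 * d ^ 2 + 4 * I 3 * b * d ^ 3
      + I 4 * d ^ 4], fun x y => ?_⟩
  simp only [quartic, Matrix.cons_val]
  ring

/-- The linear change of coordinates that brings a `3`-jet to standard form is determined by the
jet up to the symmetries of the standard form. -/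
theorem shift_and_scale_eq {j : Fin 7 → ℝ} {c α β l₁₁ l₁₂ l₂₁ l₂₂ m₁ m₂ : ℝ}
    (hc : c ≠ 0) (hdet : l₁₁ * l₂₂ - l₁₂ * l₂₁ ≠ 0)
    (hm₁ : m₁ = l₁₁ * α + l₁₂ * β) (hm₂ : m₂ = l₂₁ * α + l₂₂ * β)
    (h2 : ∀ a b, c * jetQuadratic j a b = (l₁₁ * a + l₁₂ * b) ^ 2 + (l₂₁ * a + l₂₂ * b) ^ 2)
    (h3 : ∀ a b, c * jetCubic j a b
      = 3 * ((l₁₁ * a + l₁₂ * b) * m₁ + (l₂₁ * a + l₂₂ * b) * m₂) * jetQuadratic j a b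
        + ((l₁₁ * a + l₁₂ * b) ^ 3 - 3 * (l₁₁ * a + l₁₂ * b) * (l₂₁ * a + l₂₂ * b) ^ 2)) :
    jetDisc j ≠ 0 ∧ j 0 ≠ 0 ∧ α = jetShift₁ j ∧ β = jetShift₂ j ∧ c = jetScale j := by
  obtain ⟨q0, q1, q2⟩ := coeff_eq_of_quadratic_eq (a := c * j 0) (b := c * (2 * j 1))
    (c := c * j 2) (a' := l₁₁ ^ 2 + l₂₁ ^ 2) (b' := 2 * (l₁₁ * l₁₂ + l₂₁ * l₂₂))
    (c' := l₁₂ ^ 2 + l₂₂ ^ 2) (fun x y => by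
      have := h2 x y
      simp only [jetQuadratic] at this
      linear_combination this)
  have q1 : c * j 1 = l₁₁ * l₁₂ + l₂₁ * l₂₂ := by linear_combination q1 / 2
  have hD : c ^ 2 * jetDisc j = (l₁₁ * l₂₂ - l₁₂ * l₂₁) ^ 2 := by
    unfold jetDisc
    linear_combination c * j 2 * q0 + (l₁₁ ^ 2 + l₂₁ ^ 2) * q2
      - (c * j 1 + (l₁₁ * l₁₂ + l₂₁ * l₂₂)) * q1
  have hD0 : jetDisc j ≠ 0 := by
    intro h0
    rw [h0, mul_zero] at hD
    exact pow_ne_zero 2 hdet hD.symm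
  have hr0 : j 0 ≠ 0 := by
    intro h0
    rw [h0, mul_zero] at q0
    have e1 : l₁₁ = 0 := by nlinarith [sq_nonneg l₁₁, sq_nonneg l₂₁]
    have e2 : l₂₁ = 0 := by nlinarith [sq_nonneg l₁₁, sq_nonneg l₂₁]
    exact hdet (by rw [e1, e2]; ring)
  obtain ⟨n₁, hn₁⟩ : ∃ n, n = j 0 * α + j 1 * β := ⟨_, rfl⟩
  obtain ⟨n₂, hn₂⟩ : ∃ n, n = j 1 * α + j 2 * β := ⟨_, rfl⟩
  have hn₁' : c * n₁ = l₁₁ * m₁ + l₂₁ * m₂ := by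
    rw [hn₁, hm₁, hm₂]; linear_combination α * q0 + β * q1
  have hn₂' : c * n₂ = l₁₂ * m₁ + l₂₂ * m₂ := by
    rw [hn₂, hm₁, hm₂]; linear_combination α * q1 + β * q2
  obtain ⟨k0, k1, k2, k3⟩ := coeff_eq_of_cubic_eq
    (a := c * (j 3 - 3 * n₁ * j 0)) (b := 3 * (c * (j 4 - (2 * n₁ * j 1 + n₂ * j 0))))
    (c := 3 * (c * (j 5 - (n₁ * j 2 + 2 * n₂ * j 1)))) (d := c * (j 6 - 3 * n₂ * j 2))
    (a' := l₁₁ ^ 3 - 3 * l₁₁ * l₂₁ ^ 2)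
    (b' := 3 * (l₁₁ ^ 2 * l₁₂ - l₂₁ ^ 2 * l₁₂ - 2 * l₁₁ * l₂₁ * l₂₂))
    (c' := 3 * (l₁₁ * l₁₂ ^ 2 - l₁₁ * l₂₂ ^ 2 - 2 * l₂₁ * l₁₂ * l₂₂))
    (d' := l₁₂ ^ 3 - 3 * l₁₂ * l₂₂ ^ 2) (fun x y => by
      have := h3 x y
      simp only [jetQuadratic, jetCubic] at this
      linear_combination this
        - 3 * (j 0 * x ^ 2 + 2 * j 1 * x * y + j 2 * y ^ 2) * (x * hn₁' + y * hn₂'))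
  have k1 := mul_left_cancel₀ (by norm_num : (3 : ℝ) ≠ 0) k1
  have k2 := mul_left_cancel₀ (by norm_num : (3 : ℝ) ≠ 0) k2
  obtain ⟨κ0, hκ0⟩ : ∃ n, n = j 3 - 3 * n₁ * j 0 := ⟨_, rfl⟩
  obtain ⟨κ1, hκ1⟩ : ∃ n, n = j 4 - (2 * n₁ * j 1 + n₂ * j 0) := ⟨_, rfl⟩
  obtain ⟨κ2, hκ2⟩ : ∃ n, n = j 5 - (n₁ * j 2 + 2 * n₂ * j 1) := ⟨_, rfl⟩
  obtain ⟨κ3, hκ3⟩ : ∃ n, n = j 6 - 3 * n₂ * j 2 := ⟨_, rfl⟩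
  rw [← hκ0] at k0
  rw [← hκ1] at k1
  rw [← hκ2] at k2
  rw [← hκ3] at k3
  -- The reduced cubic κ is a multiple of the standard cubic composed with L, and Q is a multiple of
  -- |L|². Harmonicity of the standard cubic makes both components of the trace of κ with respect to
  -- Q vanish.
  have t1 : j 2 * κ0 - 2 * j 1 * κ1 + j 0 * κ2 = 0 := by
    have : c ^ 2 * (j 2 * κ0 - 2 * j 1 * κ1 + j 0 * κ2) = 0 := by
      calc _ = (c * j 2) * (c * κ0) - 2 * (c * j 1) * (c * κ1) + (c * j 0) * (c * κ2) := by ring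
        _ = 0 := by rw [q0, q1, q2, k0, k1, k2]; ring
    exact (mul_eq_zero.1 this).resolve_left (pow_ne_zero 2 hc)
  have t2 : j 2 * κ1 - 2 * j 1 * κ2 + j 0 * κ3 = 0 := by
    have : c ^ 2 * (j 2 * κ1 - 2 * j 1 * κ2 + j 0 * κ3) = 0 := by
      calc _ = (c * j 2) * (c * κ1) - 2 * (c * j 1) * (c * κ2) + (c * j 0) * (c * κ3) := by ring
        _ = 0 := by rw [q0, q1, q2, k1, k2, k3]; ring
    exact (mul_eq_zero.1 this).resolve_left (pow_ne_zero 2 hc)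
  -- The Hessian is a covariant: it picks up det² under L, and for the standard cubic it is x² + y²
  -- up to a constant. Comparing the coefficients of a² determines c.
  have hs : κ1 ^ 2 - κ0 * κ2 = c * (jetDisc j * j 0) := by
    have : c ^ 2 * (κ1 ^ 2 - κ0 * κ2) = c ^ 2 * (c * (jetDisc j * j 0)) := by
      calc _ = (c * κ1) ^ 2 - (c * κ0) * (c * κ2) := by ring
        _ = (l₁₁ * l₂₂ - l₁₂ * l₂₁) ^ 2 * (l₁₁ ^ 2 + l₂₁ ^ 2) := by rw [k0, k1, k2]; ring
        _ = _ := by rw [← hD, ← q0]; ring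
    exact mul_left_cancel₀ (pow_ne_zero 2 hc) this
  -- The trace of 3νQ, with ν = n₁ a + n₂ b, is 4 · disc · ν. This is the origin of the factor 4.
  have hν₁ : jetTrace₁ j = n₁ := by
    rw [jetTrace₁, div_eq_iff (mul_ne_zero four_ne_zero hD0)]
    unfold jetDisc
    rw [hκ0, hκ1, hκ2] at t1
    linear_combination t1
  have hν₂ : jetTrace₂ j = n₂ := by
    rw [jetTrace₂, div_eq_iff (mul_ne_zero four_ne_zero hD0)]
    unfold jetDisc
    rw [hκ1, hκ2, hκ3] at t2
    linear_combination t2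
  refine ⟨hD0, hr0, ?_, ?_, ?_⟩
  · rw [jetShift₁, eq_div_iff hD0, hν₁, hν₂, hn₁, hn₂]
    unfold jetDisc; ring
  · rw [jetShift₂, eq_div_iff hD0, hν₁, hν₂, hn₁, hn₂]
    unfold jetDisc; ring
  · rw [jetScale, eq_div_iff (mul_ne_zero hD0 hr0), hν₁, hν₂, ← hκ0, ← hκ1, ← hκ2, ← hs]

/-! ### The symmetries of the standard form -/

/-- The column (a, c) is the vertex to which (1, 0) is sent. It fixes the power of `sigma`, and the
orientation fixes the power of `tau`. -/
theorem mem_D3_of_entries {a c : ℝ} {M : Matrix (Fin 2) (Fin 2) ℝ}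
    (hac : (a = 1 ∧ c = 0) ∨ (a = -1 / 2 ∧ c = Real.sqrt 3 / 2) ∨
      (a = -1 / 2 ∧ c = -(Real.sqrt 3 / 2)))
    (hM : M = !![a, -c; c, a] ∨ M = !![a, c; c, -a]) : M ∈ D3 := by
  have h3 : Real.sqrt 3 * Real.sqrt 3 = 3 := Real.mul_self_sqrt (by norm_num)
  have hs2 : sigma ^ 2 = !![-1 / 2, Real.sqrt 3 / 2; -(Real.sqrt 3 / 2), -1 / 2] := by
    rw [pow_two, sigma]
    ext i j
    fin_cases i <;> fin_cases j <;> simp [Matrix.mul_apply, Fin.sum_univ_two] <;> linarith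
  rcases hac with ⟨rfl, rfl⟩ | ⟨rfl, rfl⟩ | ⟨rfl, rfl⟩
  · rcases hM with rfl | rfl
    · exact ⟨0, by norm_num, 0, by norm_num, by ext i j; fin_cases i <;> fin_cases j <;> simp⟩
    · exact ⟨0, by norm_num, 1, by norm_num, by
        ext i j; fin_cases i <;> fin_cases j <;> simp [tau]⟩
  · rcases hM with rfl | rfl
    · exact ⟨1, by norm_num, 0, by norm_num, by
        ext i j; fin_cases i <;> fin_cases j <;> simp [sigma]⟩
    · exact ⟨1, by norm_num, 1, by norm_num, by
        ext i j
        fin_cases i <;> fin_cases j <;>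
          simp [sigma, tau, Matrix.mul_apply, Fin.sum_univ_two, neg_div]⟩
  · rcases hM with rfl | rfl
    · exact ⟨2, by norm_num, 0, by norm_num, by
        rw [hs2]; ext i j; fin_cases i <;> fin_cases j <;> simp⟩
    · exact ⟨2, by norm_num, 1, by norm_num, by
        rw [hs2]
        ext i j
        fin_cases i <;> fin_cases j <;>
          simp [tau, Matrix.mul_apply, Fin.sum_univ_two, neg_div]⟩

/-- A linear map of the plane preserves `x² + y²` and `x³ - 3 x y²`. -/
def PreservesStandard (M : Matrix (Fin 2) (Fin 2) ℝ) : Prop :=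
  ∀ x y : ℝ, (M 0 0 * x + M 0 1 * y) ^ 2 + (M 1 0 * x + M 1 1 * y) ^ 2 = x ^ 2 + y ^ 2 ∧
    (M 0 0 * x + M 0 1 * y) ^ 3
      - 3 * (M 0 0 * x + M 0 1 * y) * (M 1 0 * x + M 1 1 * y) ^ 2 = x ^ 3 - 3 * x * y ^ 2

theorem PreservesStandard.mul {M N : Matrix (Fin 2) (Fin 2) ℝ} (hM : PreservesStandard M)
    (hN : PreservesStandard N) : PreservesStandard (M * N) := by
  intro x y
  have h1 := hM (N 0 0 * x + N 0 1 * y) (N 1 0 * x + N 1 1 * y)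
  have h2 := hN x y
  rw [h2.1, h2.2] at h1
  simp only [Matrix.mul_apply, Fin.sum_univ_two]
  exact ⟨by rw [← h1.1]; ring, by rw [← h1.2]; ring⟩

theorem preservesStandard_one : PreservesStandard 1 := fun x y => by simp

theorem PreservesStandard.pow {M : Matrix (Fin 2) (Fin 2) ℝ} (hM : PreservesStandard M) (k : ℕ) :
    PreservesStandard (M ^ k) := by
  induction k with
  | zero => simpa using preservesStandard_one
  | succ k ih => rw [pow_succ]; exact ih.mul hM

/-- Preserving x² + y² means orthogonality. With first column (cos θ, sin θ), the value of the cubic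
at (1, 0) gives cos 3θ = 1, which leaves the three vertices of the triangle; the second column is
then determined up to sign. -/
theorem mem_D3_iff {M : Matrix (Fin 2) (Fin 2) ℝ} : M ∈ D3 ↔ PreservesStandard M := by
  have h3 : Real.sqrt 3 * Real.sqrt 3 = 3 := Real.mul_self_sqrt (by norm_num)
  constructor
  · rintro ⟨k, -, l, -, rfl⟩
    refine PreservesStandard.mul (PreservesStandard.pow (fun x y => ?_) k)
      (PreservesStandard.pow (fun x y => ?_) l)
    · simp only [sigma, Matrix.of_apply, Matrix.cons_val', Matrix.cons_val_zero,
        Matrix.cons_val_one, Matrix.cons_val_fin_one]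
      constructor
      · linear_combination (x ^ 2 + y ^ 2) / 4 * h3
      · linear_combination (3 / 8 * x ^ 3 + 3 / 8 * Real.sqrt 3 * x ^ 2 * y
          - 9 / 8 * x * y ^ 2 - 1 / 8 * Real.sqrt 3 * y ^ 3) * h3
    · simp only [tau, Matrix.of_apply, Matrix.cons_val', Matrix.cons_val_zero,
        Matrix.cons_val_one, Matrix.cons_val_fin_one]
      constructor <;> ring
  · intro h
    obtain ⟨a, ha⟩ : ∃ a, a = M 0 0 := ⟨_, rfl⟩
    obtain ⟨b, hb⟩ : ∃ a, a = M 0 1 := ⟨_, rfl⟩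
    obtain ⟨c, hc⟩ : ∃ a, a = M 1 0 := ⟨_, rfl⟩
    obtain ⟨d, hd⟩ : ∃ a, a = M 1 1 := ⟨_, rfl⟩
    have hMe : M = !![a, b; c, d] := by
      rw [ha, hb, hc, hd]; exact Matrix.eta_fin_two M
    have e1 := h 1 0
    have e2 := h 0 1
    have e3 := h 1 1
    rw [← ha, ← hb, ← hc, ← hd] at e1 e2 e3
    have n1 : a ^ 2 + c ^ 2 = 1 := by linear_combination e1.1
    have n2 : b ^ 2 + d ^ 2 = 1 := by linear_combination e2.1
    have n3 : a * b + c * d = 0 := by linear_combination (e3.1 - e1.1 - e2.1) / 2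
    -- Triple angle formula for a = cos θ; the double root a = -1/2 accounts for two vertices.
    have c1 : 4 * a ^ 3 - 3 * a = 1 := by linear_combination e1.2 + 3 * a * n1
    have hfac : (a - 1) * (2 * a + 1) ^ 2 = 0 := by linear_combination c1
    have hac : (a = 1 ∧ c = 0) ∨ (a = -1 / 2 ∧ c = Real.sqrt 3 / 2) ∨
        (a = -1 / 2 ∧ c = -(Real.sqrt 3 / 2)) := by
      rcases mul_eq_zero.1 hfac with h0 | h0
      · left
        have h1 : a = 1 := by linarith
        refine ⟨h1, ?_⟩
        have : c ^ 2 = 0 := by rw [h1] at n1; linarith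
        exact pow_eq_zero_iff two_ne_zero |>.1 this
      · right
        have h1 : a = -1 / 2 := by
          have := pow_eq_zero_iff two_ne_zero |>.1 h0
          linarith
        have h2 : (c - Real.sqrt 3 / 2) * (c + Real.sqrt 3 / 2) = 0 := by
          rw [h1] at n1; linear_combination n1 - h3 / 4
        rcases mul_eq_zero.1 h2 with h2 | h2
        · exact Or.inl ⟨h1, by linarith⟩
        · exact Or.inr ⟨h1, by linarith⟩
    refine mem_D3_of_entries hac ?_
    have hb1 : b = -(c * (a * d - b * c)) := by
      linear_combination -b * n1 + a * n3
    have hd1 : d = a * (a * d - b * c) := by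
      linear_combination -d * n1 + c * n3
    have hdet : (a * d - b * c - 1) * (a * d - b * c + 1) = 0 := by
      linear_combination n1 * (b ^ 2 + d ^ 2) + n2 - (a * b + c * d) * n3
    rcases mul_eq_zero.1 hdet with h0 | h0
    · left
      have h0 : a * d - b * c = 1 := by linarith
      rw [h0] at hb1 hd1
      rw [hMe, hb1, hd1]; simp
    · right
      have h0 : a * d - b * c = -1 := by linarith
      rw [h0] at hb1 hd1
      rw [hMe, hb1, hd1]; simp

theorem natCast_le_infty (n : ℕ) : (n : ℕ∞ω) ≤ ∞ :=
  WithTop.coe_le_coe.2 (le_top : (n : ℕ∞) ≤ ⊤)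

/-! ### Directional derivatives in the plane -/

/-- The derivative of `F` in the direction `h`. -/
def dirDeriv (h : ℝ × ℝ) (F : ℝ × ℝ → ℝ) (ξ : ℝ × ℝ) : ℝ := fderiv ℝ F ξ h

theorem contDiff_dirDeriv {F : ℝ × ℝ → ℝ} (hF : ContDiff ℝ ∞ F) (h : ℝ × ℝ) :
    ContDiff ℝ ∞ (dirDeriv h F) :=
  (hF.fderiv_right (by simp)).clm_apply contDiff_const

theorem dirDeriv_eq (a b : ℝ) (F : ℝ × ℝ → ℝ) :
    dirDeriv (a, b) F = fun ξ => a * dirDeriv (1, 0) F ξ + b * dirDeriv (0, 1) F ξ := by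
  funext ξ
  have : ((a, b) : ℝ × ℝ) = a • (1, 0) + b • (0, 1) := by simp
  simp only [dirDeriv]
  rw [this, map_add, map_smul, map_smul, smul_eq_mul, smul_eq_mul]

theorem dirDeriv_linear {F G : ℝ × ℝ → ℝ} (hF : ContDiff ℝ ∞ F) (hG : ContDiff ℝ ∞ G)
    (h : ℝ × ℝ) (a b : ℝ) :
    dirDeriv h (fun ξ => a * F ξ + b * G ξ) = fun ξ => a * dirDeriv h F ξ + b * dirDeriv h G ξ := by
  funext ξ
  have hF' := (hF.differentiable (by simp) ξ).hasFDerivAt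
  have hG' := (hG.differentiable (by simp) ξ).hasFDerivAt
  simp only [dirDeriv]
  have := ((hF'.const_mul a).add (hG'.const_mul b)).fderiv
  change fderiv ℝ (fun ξ => a * F ξ + b * G ξ) ξ = _ at this
  rw [this]
  simp

theorem dirDeriv_sub {F G : ℝ × ℝ → ℝ} (hF : ContDiff ℝ ∞ F) (hG : ContDiff ℝ ∞ G)
    (h : ℝ × ℝ) :
    dirDeriv h (fun ξ => F ξ - G ξ) = fun ξ => dirDeriv h F ξ - dirDeriv h G ξ := by
  have := dirDeriv_linear hF hG h 1 (-1)
  simpa [sub_eq_add_neg] using this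

theorem dirDeriv_comm {F : ℝ × ℝ → ℝ} (hF : ContDiff ℝ ∞ F) (h k : ℝ × ℝ) :
    dirDeriv h (dirDeriv k F) = dirDeriv k (dirDeriv h F) := by
  funext ξ
  have hd : DifferentiableAt ℝ (fderiv ℝ F) ξ :=
    ((hF.fderiv_right (m := ∞) (by simp)).differentiable (by simp)) ξ
  have key : ∀ h k : ℝ × ℝ, dirDeriv h (dirDeriv k F) ξ = fderiv ℝ (fderiv ℝ F) ξ h k := by
    intro h k
    have := (hd.hasFDerivAt.clm_apply (hasFDerivAt_const k ξ)).fderiv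
    simp only [dirDeriv]
    change fderiv ℝ (fun ξ => fderiv ℝ F ξ k) ξ h = _
    rw [this]; simp
  rw [key, key]
  exact (hF.contDiffAt.isSymmSndFDerivAt (by simpa using natCast_le_infty 2)) h k

theorem hasDerivAt_line {F : ℝ × ℝ → ℝ} (hF : ContDiff ℝ ∞ F) (ξ h : ℝ × ℝ) (t : ℝ) :
    HasDerivAt (fun t : ℝ => F (ξ + t • h)) (dirDeriv h F (ξ + t • h)) t := by
  have h1 : HasDerivAt (fun t : ℝ => ξ + t • h) h t := by
    simpa using ((hasDerivAt_id t).smul_const h).const_add ξ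
  exact (hF.differentiable (by simp) (ξ + t • h)).hasFDerivAt.comp_hasDerivAt t h1

theorem iteratedDeriv_line {F : ℝ × ℝ → ℝ} (hF : ContDiff ℝ ∞ F) (ξ h : ℝ × ℝ) (k : ℕ) :
    iteratedDeriv k (fun t : ℝ => F (ξ + t • h)) = fun t => ((dirDeriv h)^[k] F) (ξ + t • h) := by
  -- Smoothness of the iterates is carried through the induction, since each differentiation step
  -- needs it.
  have hk : ContDiff ℝ ∞ ((dirDeriv h)^[k] F) ∧
      iteratedDeriv k (fun t : ℝ => F (ξ + t • h)) =
        fun t => ((dirDeriv h)^[k] F) (ξ + t • h) := by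
    induction k with
    | zero => simpa using hF
    | succ k ih =>
      rw [Function.iterate_succ_apply', iteratedDeriv_succ, ih.2]
      exact ⟨contDiff_dirDeriv ih.1 h, funext fun t => (hasDerivAt_line ih.1 ξ h t).deriv⟩
  exact hk.2

/-- Taylor's formula of order four along a line. -/
theorem taylor_line {F : ℝ × ℝ → ℝ} (hF : ContDiff ℝ ∞ F) (ξ h : ℝ × ℝ) :
    (fun t : ℝ => F (ξ + t • h) - (F ξ + dirDeriv h F ξ * t
      + dirDeriv h (dirDeriv h F) ξ / 2 * t ^ 2
      + dirDeriv h (dirDeriv h (dirDeriv h F)) ξ / 6 * t ^ 3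
      + dirDeriv h (dirDeriv h (dirDeriv h (dirDeriv h F))) ξ / 24 * t ^ 4))
      =o[𝓝 0] (fun t : ℝ => t ^ 4) := by
  have hc : ContDiff ℝ ((4 : ℕ) : ℕ∞ω) (fun t : ℝ => F (ξ + t • h)) :=
    (hF.comp (by fun_prop : ContDiff ℝ ∞ fun t : ℝ => ξ + t • h)).of_le (natCast_le_infty 4)
  have := taylor_isLittleO_univ (x₀ := 0) hc
  refine (this.congr (fun t => ?_) (fun t => by simp))
  simp only [taylor_within_apply, iteratedDerivWithin_univ, iteratedDeriv_line hF,
    Finset.sum_range_succ, Finset.sum_range_zero, Function.iterate_succ_apply',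
    Function.iterate_zero, id]
  simp [Nat.factorial]
  ring

/-- The second and third derivatives of a function of two variables. -/
def jet (u : ℝ × ℝ → ℝ) (ξ : ℝ × ℝ) : Fin 7 → ℝ :=
  ![dirDeriv (1, 0) (dirDeriv (1, 0) u) ξ, dirDeriv (1, 0) (dirDeriv (0, 1) u) ξ,
    dirDeriv (0, 1) (dirDeriv (0, 1) u) ξ,
    dirDeriv (1, 0) (dirDeriv (1, 0) (dirDeriv (1, 0) u)) ξ,
    dirDeriv (1, 0) (dirDeriv (1, 0) (dirDeriv (0, 1) u)) ξ,
    dirDeriv (1, 0) (dirDeriv (0, 1) (dirDeriv (0, 1) u)) ξ,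
    dirDeriv (0, 1) (dirDeriv (0, 1) (dirDeriv (0, 1) u)) ξ]

/-- The fourth derivatives of a function of two variables. -/
def jet4 (u : ℝ × ℝ → ℝ) (ξ : ℝ × ℝ) : Fin 5 → ℝ :=
  ![dirDeriv (1, 0) (dirDeriv (1, 0) (dirDeriv (1, 0) (dirDeriv (1, 0) u))) ξ,
    dirDeriv (1, 0) (dirDeriv (1, 0) (dirDeriv (1, 0) (dirDeriv (0, 1) u))) ξ,
    dirDeriv (1, 0) (dirDeriv (1, 0) (dirDeriv (0, 1) (dirDeriv (0, 1) u))) ξ,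
    dirDeriv (1, 0) (dirDeriv (0, 1) (dirDeriv (0, 1) (dirDeriv (0, 1) u))) ξ,
    dirDeriv (0, 1) (dirDeriv (0, 1) (dirDeriv (0, 1) (dirDeriv (0, 1) u))) ξ]

theorem dirDeriv_two {u : ℝ × ℝ → ℝ} (hu : ContDiff ℝ ∞ u) (a b : ℝ) :
    dirDeriv (a, b) (dirDeriv (a, b) u) = fun ξ => jetQuadratic (jet u ξ) a b := by
  have c1 := contDiff_dirDeriv hu (1, 0)
  have c2 := contDiff_dirDeriv hu (0, 1)
  rw [dirDeriv_eq a b u, dirDeriv_linear c1 c2, dirDeriv_eq a b (dirDeriv (1, 0) u),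
    dirDeriv_eq a b (dirDeriv (0, 1) u), dirDeriv_comm hu (0, 1) (1, 0)]
  funext ξ
  simp only [jetQuadratic, jet, Matrix.cons_val]
  ring

/-- The third derivative is the second derivative of `a ∂₁ u + b ∂₂ u`, and so on. -/
theorem dirDeriv_three {u : ℝ × ℝ → ℝ} (hu : ContDiff ℝ ∞ u) (a b : ℝ) :
    dirDeriv (a, b) (dirDeriv (a, b) (dirDeriv (a, b) u))
      = fun ξ => jetCubic (jet u ξ) a b := by
  have c1 := contDiff_dirDeriv hu (1, 0)
  have c2 := contDiff_dirDeriv hu (0, 1)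
  rw [dirDeriv_two (contDiff_dirDeriv hu (a, b))]
  funext ξ
  simp only [jetQuadratic, jetCubic, jet, Matrix.cons_val]
  rw [dirDeriv_eq a b u, dirDeriv_linear c1 c2, dirDeriv_linear c1 c2,
    dirDeriv_linear (contDiff_dirDeriv c1 _) (contDiff_dirDeriv c2 _),
    dirDeriv_linear (contDiff_dirDeriv c1 _) (contDiff_dirDeriv c2 _),
    dirDeriv_linear (contDiff_dirDeriv c1 _) (contDiff_dirDeriv c2 _),
    dirDeriv_comm hu (0, 1) (1, 0), dirDeriv_comm c2 (0, 1) (1, 0)]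
  ring

theorem dirDeriv_four {u : ℝ × ℝ → ℝ} (hu : ContDiff ℝ ∞ u) (a b : ℝ) :
    dirDeriv (a, b) (dirDeriv (a, b) (dirDeriv (a, b) (dirDeriv (a, b) u)))
      = fun ξ => quartic (jet4 u ξ) a b := by
  have c1 := contDiff_dirDeriv hu (1, 0)
  have c2 := contDiff_dirDeriv hu (0, 1)
  have c11 := contDiff_dirDeriv c1 (1, 0)
  have c12 := contDiff_dirDeriv c2 (1, 0)
  have c22 := contDiff_dirDeriv c2 (0, 1)
  rw [dirDeriv_three (contDiff_dirDeriv hu (a, b))]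
  funext ξ
  simp only [jetCubic, quartic, jet, jet4, Matrix.cons_val]
  rw [dirDeriv_eq a b u, dirDeriv_linear c1 c2, dirDeriv_linear c1 c2,
    dirDeriv_comm hu (0, 1) (1, 0),
    dirDeriv_linear c11 c12, dirDeriv_linear c12 c22, dirDeriv_linear c12 c22,
    dirDeriv_linear (contDiff_dirDeriv c11 _) (contDiff_dirDeriv c12 _),
    dirDeriv_linear (contDiff_dirDeriv c12 _) (contDiff_dirDeriv c22 _),
    dirDeriv_linear (contDiff_dirDeriv c12 _) (contDiff_dirDeriv c22 _),
    dirDeriv_linear (contDiff_dirDeriv c12 _) (contDiff_dirDeriv c22 _),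
    dirDeriv_comm c2 (0, 1) (1, 0), dirDeriv_comm c22 (0, 1) (1, 0)]
  ring

/-! ### Functions that vanish to fourth order -/

theorem eq_zero_of_isLittleO {E : Type*} [NormedAddCommGroup E] {v : E → ℝ} {k : ℕ} (hk : k ≠ 0)
    (hv : v =o[𝓝 0] (fun x : E => ‖x‖ ^ k)) : v 0 = 0 := by
  have := (hv.def one_pos).self_of_nhds
  simpa [hk] using this

theorem isLittleO_line {v : ℝ × ℝ → ℝ} (hv : v =o[𝓝 0] (fun x : ℝ × ℝ => ‖x‖ ^ 4))
    (h : ℝ × ℝ) : (fun t : ℝ => v (t • h)) =o[𝓝 0] (fun t : ℝ => t ^ 4) := by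
  have hO : (fun t : ℝ => t • h) =O[𝓝 0] (fun t : ℝ => t) :=
    IsBigO.of_bound ‖h‖ (Eventually.of_forall fun t => by rw [norm_smul, mul_comm])
  exact (hv.comp_tendsto (hO.trans_tendsto tendsto_id)).trans_isBigO (hO.norm_left.pow 4)

/-- The derivatives up to order four of a smooth function that vanishes to fourth order. -/
theorem derivatives_eq_zero {v : ℝ × ℝ → ℝ} (hv : ContDiff ℝ ∞ v)
    (ho : v =o[𝓝 0] (fun x : ℝ × ℝ => ‖x‖ ^ 4)) :
    (∀ h, dirDeriv h v 0 = 0) ∧ jet v 0 = 0 ∧ jet4 v 0 = 0 := by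
  have h0 : v 0 = 0 := eq_zero_of_isLittleO (by norm_num) ho
  have key : ∀ a b : ℝ, dirDeriv (a, b) v 0 = 0 ∧ jetQuadratic (jet v 0) a b / 2 = 0 ∧
      jetCubic (jet v 0) a b / 6 = 0 ∧ quartic (jet4 v 0) a b / 24 = 0 := by
    intro a b
    have h1 := taylor_line hv 0 (a, b)
    have h2 := isLittleO_line ho (a, b)
    rw [dirDeriv_four hv, dirDeriv_three hv, dirDeriv_two hv] at h1
    -- The difference of the two estimates is minus the Taylor polynomial, which is therefore o(t⁴).
    -- Adding back the constant fourth coefficient produces the function B of `coeff_eq_zero`.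
    have h3 := (h1.sub h2).tendsto_div_nhds_zero.mono_left (nhdsWithin_le_nhds (s := {0}ᶜ))
    have h4 := h3.const_add (quartic (jet4 v 0) a b / 24)
    rw [add_zero] at h4
    refine coeff_eq_zero h4 ?_
    filter_upwards [eventually_mem_nhdsWithin] with t ht
    have ht : t ≠ 0 := ht
    field_simp
    simp only [h0, zero_add]
    ring
  refine ⟨fun h => (key h.1 h.2).1, ?_, ?_⟩
  · obtain ⟨q0, q1, q2⟩ := coeff_eq_of_quadratic_eq (a := jet v 0 0) (b := 2 * jet v 0 1)
      (c := jet v 0 2) (a' := 0) (b' := 0) (c' := 0) (fun x y => by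
        have := (key x y).2.1
        rw [jetQuadratic] at this
        linear_combination 2 * this)
    obtain ⟨k0, k1, k2, k3⟩ := coeff_eq_of_cubic_eq (a := jet v 0 3) (b := 3 * jet v 0 4)
      (c := 3 * jet v 0 5) (d := jet v 0 6) (a' := 0) (b' := 0) (c' := 0) (d' := 0)
      (fun x y => by
        have := (key x y).2.2.1
        rw [jetCubic] at this
        linear_combination 6 * this)
    funext i
    fin_cases i
    · exact q0
    · exact (mul_eq_zero.1 q1).resolve_left (by norm_num)
    · exact q2
    · exact k0
    · exact (mul_eq_zero.1 k1).resolve_left (by norm_num)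
    · exact (mul_eq_zero.1 k2).resolve_left (by norm_num)
    · exact k3
  · refine quartic_injective fun x y => ?_
    have := (key x y).2.2.2
    have h5 : quartic 0 x y = 0 := by simp [quartic]
    rw [h5]; linarith

/-! ### Functions that agree to first order at the origin -/

variable {E : Type*} [NormedAddCommGroup E] [NormedSpace ℝ E]

/-- Two functions on the plane have the same value and the same differential at the origin. -/
def TangentAtZero (F G : ℝ × ℝ → E) : Prop :=
  F 0 = G 0 ∧ ∃ D : ℝ × ℝ →L[ℝ] E, HasFDerivAt F D 0 ∧ HasFDerivAt G D 0

namespace TangentAtZero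

variable {F G F' G' H : ℝ × ℝ → E} {f g f' g' : ℝ × ℝ → ℝ}

/-- Factors that are not being compared with anything enter the sums and products below through this
case. The relation is compatible with arithmetic, so first order agreement of composite quantities
needs no explicit derivatives. -/
theorem refl (hF : DifferentiableAt ℝ F 0) : TangentAtZero F F :=
  ⟨rfl, _, hF.hasFDerivAt, hF.hasFDerivAt⟩

theorem const (c : E) : TangentAtZero (fun _ => c) (fun _ => c) := refl (by fun_prop)

theorem symm (h : TangentAtZero F G) : TangentAtZero G F :=
  ⟨h.1.symm, h.2.imp fun _ hD => hD.symm⟩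

theorem trans (h : TangentAtZero F G) (h' : TangentAtZero G H) : TangentAtZero F H := by
  obtain ⟨D, h1, h2⟩ := h.2
  obtain ⟨D', h3, h4⟩ := h'.2
  obtain rfl := h2.unique h3
  exact ⟨h.1.trans h'.1, D, h1, h4⟩

theorem congr (h : TangentAtZero F G) (hF : F' =ᶠ[𝓝 0] F) (hG : G' =ᶠ[𝓝 0] G) :
    TangentAtZero F' G' := by
  obtain ⟨D, h1, h2⟩ := h.2
  exact ⟨by rw [hF.self_of_nhds, hG.self_of_nhds, h.1], D, h1.congr_of_eventuallyEq hF,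
    h2.congr_of_eventuallyEq hG⟩

theorem add (h : TangentAtZero F G) (h' : TangentAtZero F' G') :
    TangentAtZero (fun ξ => F ξ + F' ξ) (fun ξ => G ξ + G' ξ) := by
  obtain ⟨D, h1, h2⟩ := h.2
  obtain ⟨D', h3, h4⟩ := h'.2
  exact ⟨by simp only [h.1, h'.1], _, h1.add h3, h2.add h4⟩

theorem sub (h : TangentAtZero F G) (h' : TangentAtZero F' G') :
    TangentAtZero (fun ξ => F ξ - F' ξ) (fun ξ => G ξ - G' ξ) := by
  obtain ⟨D, h1, h2⟩ := h.2
  obtain ⟨D', h3, h4⟩ := h'.2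
  exact ⟨by simp only [h.1, h'.1], _, h1.sub h3, h2.sub h4⟩

theorem smul (h : TangentAtZero f g) (h' : TangentAtZero F G) :
    TangentAtZero (fun ξ => f ξ • F ξ) (fun ξ => g ξ • G ξ) := by
  obtain ⟨D, h1, h2⟩ := h.2
  obtain ⟨D', h3, h4⟩ := h'.2
  refine ⟨by simp only [h.1, h'.1], _, h1.smul h3, ?_⟩
  rw [h.1, h'.1]
  exact h2.smul h4

theorem mul (h : TangentAtZero f g) (h' : TangentAtZero f' g') :
    TangentAtZero (fun ξ => f ξ * f' ξ) (fun ξ => g ξ * g' ξ) := h.smul h'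

theorem const_mul (h : TangentAtZero f g) (c : ℝ) :
    TangentAtZero (fun ξ => c * f ξ) (fun ξ => c * g ξ) := (const c).mul h

theorem pow (h : TangentAtZero f g) (k : ℕ) :
    TangentAtZero (fun ξ => f ξ ^ k) (fun ξ => g ξ ^ k) := by
  induction k with
  | zero => simpa using const (1 : ℝ)
  | succ k ih => simpa only [pow_succ] using ih.mul h

theorem inv (h : TangentAtZero f g) (h0 : f 0 ≠ 0) :
    TangentAtZero (fun ξ => (f ξ)⁻¹) (fun ξ => (g ξ)⁻¹) := by
  obtain ⟨D, h1, h2⟩ := h.2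
  refine ⟨by simp only [h.1], _, (hasDerivAt_inv h0).comp_hasFDerivAt 0 h1, ?_⟩
  rw [h.1] at h0 ⊢
  exact (hasDerivAt_inv h0).comp_hasFDerivAt 0 h2

theorem div (h : TangentAtZero f g) (h' : TangentAtZero f' g') (h0 : f' 0 ≠ 0) :
    TangentAtZero (fun ξ => f ξ / f' ξ) (fun ξ => g ξ / g' ξ) := by
  simpa only [div_eq_mul_inv] using h.mul (h'.inv h0)

/-- A reparametrization that fixes the origin and has identity differential there does not affect
the 1-jet. It serves to compare u with u' ∘ φ. -/
theorem comp_right (h : TangentAtZero F G) {φ : ℝ × ℝ → ℝ × ℝ} (h0 : φ 0 = 0)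
    (hφ : HasFDerivAt φ (ContinuousLinearMap.id ℝ (ℝ × ℝ)) 0) :
    TangentAtZero F (fun ξ => G (φ ξ)) := by
  obtain ⟨D, h1, h2⟩ := h.2
  refine ⟨by simp only [h0, h.1], D, h1, ?_⟩
  have h2' : HasFDerivAt G D (φ 0) := by rwa [h0]
  have := h2'.comp 0 hφ
  rwa [ContinuousLinearMap.comp_id] at this

theorem hasFDerivAt_zero {c : E} (h : TangentAtZero F (fun _ => c)) :
    HasFDerivAt F (0 : ℝ × ℝ →L[ℝ] E) 0 := by
  obtain ⟨D, h1, h2⟩ := h.2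
  rwa [h2.unique (hasFDerivAt_const c 0)] at h1

end TangentAtZero

theorem tangentAtZero_of_dirDeriv_eq_zero {F G : ℝ × ℝ → ℝ} (hF : ContDiff ℝ ∞ F)
    (hG : ContDiff ℝ ∞ G) (h0 : F 0 = G 0)
    (h1 : dirDeriv (1, 0) F 0 = dirDeriv (1, 0) G 0)
    (h2 : dirDeriv (0, 1) F 0 = dirDeriv (0, 1) G 0) : TangentAtZero F G := by
  have hF' := (hF.differentiable (by simp) 0).hasFDerivAt
  have hG' := (hG.differentiable (by simp) 0).hasFDerivAt
  have : fderiv ℝ F 0 = fderiv ℝ G 0 := by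
    refine ContinuousLinearMap.ext fun h => ?_
    have e1 := congrFun (dirDeriv_eq h.1 h.2 F) 0
    have e2 := congrFun (dirDeriv_eq h.1 h.2 G) 0
    simp only [h1, h2] at e1 e2
    exact e1.trans e2.symm
  exact ⟨h0, _, hF', this ▸ hG'⟩

theorem contDiff_jet {u : ℝ × ℝ → ℝ} (hu : ContDiff ℝ ∞ u) (i : Fin 7) :
    ContDiff ℝ ∞ (fun ξ => jet u ξ i) := by
  have c1 := contDiff_dirDeriv hu (1, 0)
  have c2 := contDiff_dirDeriv hu (0, 1)
  have c11 := contDiff_dirDeriv c1 (1, 0)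
  have c12 := contDiff_dirDeriv c2 (1, 0)
  have c22 := contDiff_dirDeriv c2 (0, 1)
  fin_cases i
  · exact c11
  · exact c12
  · exact c22
  · exact contDiff_dirDeriv c11 (1, 0)
  · exact contDiff_dirDeriv c12 (1, 0)
  · exact contDiff_dirDeriv c22 (1, 0)
  · exact contDiff_dirDeriv c22 (0, 1)

theorem jet_sub {u u' : ℝ × ℝ → ℝ} (hu : ContDiff ℝ ∞ u) (hu' : ContDiff ℝ ∞ u') (ξ : ℝ × ℝ) :
    jet (fun ξ => u ξ - u' ξ) ξ = jet u ξ - jet u' ξ ∧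
      jet4 (fun ξ => u ξ - u' ξ) ξ = jet4 u ξ - jet4 u' ξ := by
  have c1 := contDiff_dirDeriv hu (1, 0)
  have c2 := contDiff_dirDeriv hu (0, 1)
  have c11 := contDiff_dirDeriv c1 (1, 0)
  have c12 := contDiff_dirDeriv c2 (1, 0)
  have c22 := contDiff_dirDeriv c2 (0, 1)
  have c1' := contDiff_dirDeriv hu' (1, 0)
  have c2' := contDiff_dirDeriv hu' (0, 1)
  have c11' := contDiff_dirDeriv c1' (1, 0)
  have c12' := contDiff_dirDeriv c2' (1, 0)
  have c22' := contDiff_dirDeriv c2' (0, 1)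
  constructor <;> funext i <;> fin_cases i <;>
    simp [jet, jet4, dirDeriv_sub, hu, hu', c1, c2, c11, c12, c22, c1', c2', c11', c12', c22',
      contDiff_dirDeriv]

/-- The derivatives of the components of the jet are again derivatives of the function. -/
theorem dirDeriv_jet {u : ℝ × ℝ → ℝ} (hu : ContDiff ℝ ∞ u) (ξ : ℝ × ℝ) (i : Fin 7) :
    dirDeriv (1, 0) (fun ξ => jet u ξ i) ξ = ![jet u ξ 3, jet u ξ 4, jet u ξ 5,
      jet4 u ξ 0, jet4 u ξ 1, jet4 u ξ 2, jet4 u ξ 3] i ∧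
    dirDeriv (0, 1) (fun ξ => jet u ξ i) ξ = ![jet u ξ 4, jet u ξ 5, jet u ξ 6,
      jet4 u ξ 1, jet4 u ξ 2, jet4 u ξ 3, jet4 u ξ 4] i := by
  have c1 := contDiff_dirDeriv hu (1, 0)
  have c2 := contDiff_dirDeriv hu (0, 1)
  have c11 := contDiff_dirDeriv c1 (1, 0)
  have c12 := contDiff_dirDeriv c2 (1, 0)
  have c22 := contDiff_dirDeriv c2 (0, 1)
  have s := dirDeriv_comm hu (0, 1) (1, 0)
  have s1 := dirDeriv_comm c1 (0, 1) (1, 0)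
  have s2 := dirDeriv_comm c2 (0, 1) (1, 0)
  have s11 := dirDeriv_comm c11 (0, 1) (1, 0)
  have s12 := dirDeriv_comm c12 (0, 1) (1, 0)
  have s22 := dirDeriv_comm c22 (0, 1) (1, 0)
  fin_cases i <;> refine ⟨rfl, ?_⟩ <;> simp [jet, jet4, s, s1, s2, s11, s12, s22]

/-- Smooth functions with the same `4`-jet have derivatives of order up to three that agree to
first order. -/
theorem tangentAtZero_derivatives {u u' : ℝ × ℝ → ℝ} (hu : ContDiff ℝ ∞ u)
    (hu' : ContDiff ℝ ∞ u')
    (ho : (fun ξ => u ξ - u' ξ) =o[𝓝 0] (fun x : ℝ × ℝ => ‖x‖ ^ 4)) :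
    (∀ h, TangentAtZero (dirDeriv h u) (dirDeriv h u')) ∧
    ∀ i, TangentAtZero (fun ξ => jet u ξ i) (fun ξ => jet u' ξ i) := by
  obtain ⟨d1, d2, d4⟩ := derivatives_eq_zero (hu.sub hu') ho
  have d2 := sub_eq_zero.1 ((jet_sub hu hu' 0).1.symm.trans d2)
  have d4 := sub_eq_zero.1 ((jet_sub hu hu' 0).2.symm.trans d4)
  have d1 : ∀ h, dirDeriv h u 0 = dirDeriv h u' 0 := fun h =>
    sub_eq_zero.1 ((congrFun (dirDeriv_sub hu hu' h) 0).symm.trans (d1 h))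
  have two : ∀ (w : ℝ × ℝ → ℝ) (_ : ContDiff ℝ ∞ w) (a b c d : ℝ),
      dirDeriv (a, b) (dirDeriv (c, d) w) 0 = a * c * jet w 0 0
        + (a * d + b * c) * jet w 0 1 + b * d * jet w 0 2 := by
    intro w hw a b c d
    have c1 := contDiff_dirDeriv hw (1, 0)
    have c2 := contDiff_dirDeriv hw (0, 1)
    rw [dirDeriv_eq c d w, dirDeriv_linear c1 c2, dirDeriv_eq a b (dirDeriv (1, 0) w),
      dirDeriv_eq a b (dirDeriv (0, 1) w), dirDeriv_comm hw (0, 1) (1, 0)]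
    simp only [jet, Matrix.cons_val]
    ring
  refine ⟨fun h => ?_, fun i => ?_⟩
  · exact tangentAtZero_of_dirDeriv_eq_zero (contDiff_dirDeriv hu h) (contDiff_dirDeriv hu' h)
      (d1 h) (by rw [two u hu 1 0 h.1 h.2, two u' hu' 1 0 h.1 h.2, d2])
      (by rw [two u hu 0 1 h.1 h.2, two u' hu' 0 1 h.1 h.2, d2])
  · refine tangentAtZero_of_dirDeriv_eq_zero (contDiff_jet hu i) (contDiff_jet hu' i)
      (congrFun d2 i) ?_ ?_
    · rw [(dirDeriv_jet hu 0 i).1, (dirDeriv_jet hu' 0 i).1, d2, d4]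
    · rw [(dirDeriv_jet hu 0 i).2, (dirDeriv_jet hu' 0 i).2, d2, d4]

/-! ### Graphs and normal forms -/

/-- Only the germ of u at the origin matters, so u may be multiplied by a bump function. A globally
smooth u avoids domains in all later derivatives. -/
theorem IsNormalForm.exists_contDiff {S : Set A3} {p : A3} {e : Module.Basis (Fin 3) ℝ A3}
    {I : Fin 5 → ℝ} (h : IsNormalForm S p e I) :
    ∃ u : ℝ × ℝ → ℝ, ContDiff ℝ ∞ u ∧
      (∀ᶠ q in 𝓝 p,
        (q ∈ S ↔ e.coord 2 (q - p) = u (e.coord 0 (q - p), e.coord 1 (q - p)))) ∧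
      (fun t : ℝ × ℝ => u t - standardJet I t.1 t.2) =o[𝓝 0] (fun t : ℝ × ℝ => ‖t‖ ^ 4) := by
  obtain ⟨u, ⟨U, hU, hu⟩, hS, ho⟩ := h
  obtain ⟨r, hr, hrU⟩ := Metric.mem_nhds_iff.1 hU
  let b : ContDiffBump (0 : ℝ × ℝ) := ⟨r / 4, r / 2, by positivity, by linarith⟩
  have heq : (fun t => b t * u t) =ᶠ[𝓝 0] u := by
    filter_upwards [b.eventuallyEq_one] with t ht
    rw [ht]; simp
  refine ⟨fun t => b t * u t, ?_, ?_, ?_⟩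
  · refine contDiff_iff_contDiffAt.2 fun x => ?_
    by_cases hx : x ∈ tsupport fun t => b t * u t
    swap
    · exact contDiffAt_const.congr_of_eventuallyEq (notMem_tsupport_iff_eventuallyEq.1 hx)
    have hx' : x ∈ Metric.ball (0 : ℝ × ℝ) r := by
      have h1 : x ∈ tsupport b := tsupport_mul_subset_left hx
      rw [b.tsupport_eq] at h1
      exact Metric.closedBall_subset_ball (show r / 2 < r by linarith) h1
    exact b.contDiff.contDiffAt.mul
      (hu.contDiffAt (mem_of_superset (Metric.isOpen_ball.mem_nhds hx') hrU))
  · have ht : Tendsto (fun q => (e.coord 0 (q - p), e.coord 1 (q - p))) (𝓝 p) (𝓝 0) := by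
      have hc : Continuous fun q => (e.coord 0 (q - p), e.coord 1 (q - p)) :=
        ((LinearMap.continuous_of_finiteDimensional (e.coord 0)).comp
          (continuous_id.sub continuous_const)).prodMk
        ((LinearMap.continuous_of_finiteDimensional (e.coord 1)).comp
          (continuous_id.sub continuous_const))
      have := hc.tendsto p
      simp only [sub_self, map_zero] at this
      exact this
    filter_upwards [hS, ht.eventually heq] with q h1 h2
    rw [h2]; exact h1
  · exact ho.congr' (heq.symm.mono fun t ht =>
      congrArg (fun x => x - standardJet I t.1 t.2) ht) EventuallyEq.rfl

theorem continuous_coord (e : Module.Basis (Fin 3) ℝ A3) (i : Fin 3) :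
    Continuous (e.coord i) := LinearMap.continuous_of_finiteDimensional _

theorem coord_ext (e : Module.Basis (Fin 3) ℝ A3) {v w : A3} (h0 : e.coord 0 v = e.coord 0 w)
    (h1 : e.coord 1 v = e.coord 1 w) (h2 : e.coord 2 v = e.coord 2 w) : v = w := by
  refine e.ext_elem fun i => ?_
  fin_cases i
  exacts [h0, h1, h2]

theorem coord_basis (e : Module.Basis (Fin 3) ℝ A3) (i j : Fin 3) :
    e.coord i (e j) = if i = j then 1 else 0 := by
  rw [Module.Basis.coord_apply, e.repr_self, Finsupp.single_apply]
  simp only [eq_comm]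

/-- The parametrization of the graph of `u` in the affine coordinates with origin `p` and basis
`e`. -/
def graphMap (e : Module.Basis (Fin 3) ℝ A3) (p : A3) (u : ℝ × ℝ → ℝ) (ξ : ℝ × ℝ) : A3 :=
  p + (ξ.1 • e 0 + ξ.2 • e 1 + u ξ • e 2)

/-- The differential of `graphMap`. -/
def graphDeriv (e : Module.Basis (Fin 3) ℝ A3) (u : ℝ × ℝ → ℝ) (ξ : ℝ × ℝ) : ℝ × ℝ →L[ℝ] A3 :=
  (ContinuousLinearMap.fst ℝ ℝ ℝ).smulRight (e 0) + (ContinuousLinearMap.snd ℝ ℝ ℝ).smulRight (e 1)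
    + (fderiv ℝ u ξ).smulRight (e 2)

theorem graphDeriv_apply (e : Module.Basis (Fin 3) ℝ A3) (u : ℝ × ℝ → ℝ) (ξ h : ℝ × ℝ) :
    graphDeriv e u ξ h = h.1 • e 0 + h.2 • e 1 + dirDeriv h u ξ • e 2 := rfl

theorem hasFDerivAt_graphMap (e : Module.Basis (Fin 3) ℝ A3) (p : A3) {u : ℝ × ℝ → ℝ}
    (hu : ContDiff ℝ ∞ u) (ξ : ℝ × ℝ) : HasFDerivAt (graphMap e p u) (graphDeriv e u ξ) ξ := by
  have h1 : HasFDerivAt (fun ξ : ℝ × ℝ => ξ.1) (ContinuousLinearMap.fst ℝ ℝ ℝ) ξ := hasFDerivAt_fst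
  have h2 : HasFDerivAt (fun ξ : ℝ × ℝ => ξ.2) (ContinuousLinearMap.snd ℝ ℝ ℝ) ξ := hasFDerivAt_snd
  have h3 := (hu.differentiable (by simp) ξ).hasFDerivAt
  exact (((h1.smul_const (e 0)).add (h2.smul_const (e 1))).add (h3.smul_const (e 2))).const_add p

theorem contDiff_graphMap (e : Module.Basis (Fin 3) ℝ A3) (p : A3) {u : ℝ × ℝ → ℝ}
    (hu : ContDiff ℝ ∞ u) : ContDiff ℝ ∞ (graphMap e p u) := by
  unfold graphMap
  exact contDiff_const.add (((contDiff_fst.smul contDiff_const).add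
    (contDiff_snd.smul contDiff_const)).add (hu.smul contDiff_const))

section
variable (e : Module.Basis (Fin 3) ℝ A3) (p : A3) (u : ℝ × ℝ → ℝ) (ξ h : ℝ × ℝ)

theorem coord_zero_graphMap : e.coord 0 (graphMap e p u ξ - p) = ξ.1 := by
  simp [graphMap, coord_basis, -Module.Basis.coord_apply]

theorem coord_one_graphMap : e.coord 1 (graphMap e p u ξ - p) = ξ.2 := by
  simp [graphMap, coord_basis, -Module.Basis.coord_apply]

theorem coord_two_graphMap : e.coord 2 (graphMap e p u ξ - p) = u ξ := by
  simp [graphMap, coord_basis, -Module.Basis.coord_apply]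

theorem coord_zero_graphDeriv : e.coord 0 (graphDeriv e u ξ h) = h.1 := by
  simp [graphDeriv_apply, coord_basis, -Module.Basis.coord_apply]

theorem coord_one_graphDeriv : e.coord 1 (graphDeriv e u ξ h) = h.2 := by
  simp [graphDeriv_apply, coord_basis, -Module.Basis.coord_apply]

theorem coord_two_graphDeriv : e.coord 2 (graphDeriv e u ξ h) = dirDeriv h u ξ := by
  simp [graphDeriv_apply, coord_basis, -Module.Basis.coord_apply]

theorem graphMap_zero (h0 : u 0 = 0) : graphMap e p u 0 = p := by simp [graphMap, h0]

end

theorem value_zero_of_normal {u : ℝ × ℝ → ℝ} {I : Fin 5 → ℝ}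
    (ho : (fun t : ℝ × ℝ => u t - standardJet I t.1 t.2) =o[𝓝 0] (fun t : ℝ × ℝ => ‖t‖ ^ 4)) :
    u 0 = 0 := by
  have := eq_zero_of_isLittleO (by norm_num) ho
  simpa [standardJet, quartic] using this

theorem eventually_graphMap_mem {S : Set A3} {p : A3} {e : Module.Basis (Fin 3) ℝ A3}
    {u : ℝ × ℝ → ℝ} (hu : ContDiff ℝ ∞ u) (h0 : u 0 = 0)
    (hS : ∀ᶠ q in 𝓝 p,
      (q ∈ S ↔ e.coord 2 (q - p) = u (e.coord 0 (q - p), e.coord 1 (q - p)))) :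
    ∀ᶠ ξ in 𝓝 0, graphMap e p u ξ ∈ S := by
  have hc := (contDiff_graphMap e p hu).continuous.tendsto 0
  rw [graphMap_zero e p u h0] at hc
  filter_upwards [hc.eventually hS] with ξ hξ
  rw [hξ, coord_zero_graphMap, coord_one_graphMap, coord_two_graphMap]

theorem eventually_eq_graphMap {S : Set A3} {p : A3} {e : Module.Basis (Fin 3) ℝ A3}
    {u : ℝ × ℝ → ℝ}
    (hS : ∀ᶠ q in 𝓝 p,
      (q ∈ S ↔ e.coord 2 (q - p) = u (e.coord 0 (q - p), e.coord 1 (q - p)))) :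
    ∀ᶠ q in 𝓝 p, q ∈ S → q = graphMap e p u (e.coord 0 (q - p), e.coord 1 (q - p)) := by
  filter_upwards [hS] with q hq hqS
  have h2 := hq.1 hqS
  rw [← sub_left_inj (a := p)]
  refine coord_ext e ?_ ?_ ?_
  · rw [coord_zero_graphMap]
  · rw [coord_one_graphMap]
  · rw [coord_two_graphMap, h2]

/-- The jet of a curve in a surface in the coordinates of a normalizing frame. -/
theorem IsNormalForm.curve_expansion {S : Set A3} {q : A3} {e : Module.Basis (Fin 3) ℝ A3}
    {I : Fin 5 → ℝ} (h : IsNormalForm S q e I) {v b : A3} {w : ℝ → ℝ} {w₂ w₃ w₄ : ℝ}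
    (hw : (fun t => w t - (w₂ * t ^ 2 + w₃ * t ^ 3 + w₄ * t ^ 4)) =o[𝓝 0] (fun t : ℝ => t ^ 4))
    (hS : ∀ᶠ t in 𝓝 (0 : ℝ), q + (t • v + w t • b) ∈ S) :
    e.coord 2 v = 0 ∧ e.coord 2 b * w₂ = (e.coord 0 v ^ 2 + e.coord 1 v ^ 2) / 2 ∧
    e.coord 2 b * w₃ = (e.coord 0 v * e.coord 0 b + e.coord 1 v * e.coord 1 b) * w₂
      + (e.coord 0 v ^ 3 - 3 * e.coord 0 v * e.coord 1 v ^ 2) / 6 ∧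
    e.coord 2 b * w₄ = (e.coord 0 v * e.coord 0 b + e.coord 1 v * e.coord 1 b) * w₃
      + (e.coord 0 b ^ 2 + e.coord 1 b ^ 2) * w₂ ^ 2 / 2
      + (e.coord 0 v ^ 2 * e.coord 0 b - e.coord 1 v ^ 2 * e.coord 0 b
        - 2 * e.coord 0 v * e.coord 1 v * e.coord 1 b) * w₂ / 2
      + quartic I (e.coord 0 v) (e.coord 1 v) / 24 := by
  obtain ⟨u, -, hu, ho⟩ := h
  refine jet_comparison ho hw ?_
  have hw0 : Tendsto w (𝓝 0) (𝓝 0) := by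
    have h1 := hw.trans_tendsto (g'' := fun t : ℝ => t ^ 4)
      (by simpa using (continuous_pow 4 : Continuous fun t : ℝ => t ^ 4).tendsto 0)
    have h2 : Tendsto (fun t : ℝ => w₂ * t ^ 2 + w₃ * t ^ 3 + w₄ * t ^ 4) (𝓝 0) (𝓝 0) := by
      have : Continuous fun t : ℝ => w₂ * t ^ 2 + w₃ * t ^ 3 + w₄ * t ^ 4 := by fun_prop
      simpa using this.tendsto 0
    simpa using h1.add h2
  have ht : Tendsto (fun t : ℝ => q + (t • v + w t • b)) (𝓝 0) (𝓝 q) := by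
    have : Tendsto (fun t : ℝ => q + (t • v + w t • b)) (𝓝 0)
        (𝓝 (q + ((0 : ℝ) • v + (0 : ℝ) • b))) :=
      tendsto_const_nhds.add ((tendsto_id.smul_const v).add (hw0.smul_const b))
    simpa using this
  filter_upwards [ht.eventually hu, hS] with t h1 h2
  have h3 := h1.1 h2
  simp only [add_sub_cancel_left, map_add, map_smul, smul_eq_mul] at h3
  simpa only [mul_comm] using h3

/-- The frame relation between a normalizing frame and a moving frame adapted to a graph. -/
theorem frame_relation {e : Module.Basis (Fin 3) ℝ A3} {X : ℝ × ℝ →L[ℝ] A3} {b : A3}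
    {j : Fin 7 → ℝ} (hX : Function.Injective X) (h1 : ∀ h, e.coord 2 (X h) = 0)
    (h2 : ∀ h, e.coord 2 b * (jetQuadratic j h.1 h.2 / 2)
      = (e.coord 0 (X h) ^ 2 + e.coord 1 (X h) ^ 2) / 2)
    (h3 : ∀ h, e.coord 2 b * (jetCubic j h.1 h.2 / 6)
      = (e.coord 0 (X h) * e.coord 0 b + e.coord 1 (X h) * e.coord 1 b)
          * (jetQuadratic j h.1 h.2 / 2)
        + (e.coord 0 (X h) ^ 3 - 3 * e.coord 0 (X h) * e.coord 1 (X h) ^ 2) / 6) :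
    jetDisc j ≠ 0 ∧ j 0 ≠ 0 ∧ jetScale j ≠ 0 ∧ e.coord 2 b = jetScale j ∧
      b = jetScale j • e 2 + (jetShift₁ j • X (1, 0) + jetShift₂ j • X (0, 1)) := by
  have hlin : ∀ (i : Fin 3) (x y : ℝ),
      e.coord i (X (x, y)) = e.coord i (X (1, 0)) * x + e.coord i (X (0, 1)) * y := by
    intro i x y
    have : ((x, y) : ℝ × ℝ) = x • (1, 0) + y • (0, 1) := by simp
    rw [this, map_add, map_smul, map_smul, map_add, map_smul, map_smul, smul_eq_mul, smul_eq_mul,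
      mul_comm x, mul_comm y]
  have hz : ∀ x y : ℝ, e.coord 0 (X (x, y)) = 0 → e.coord 1 (X (x, y)) = 0 → x = 0 ∧ y = 0 := by
    intro x y hx hy
    have : X (x, y) = X 0 := by
      rw [map_zero]
      exact coord_ext e (by rw [hx, map_zero]) (by rw [hy, map_zero]) (by rw [h1, map_zero])
    simpa using hX this
  obtain ⟨l₁₁, h11⟩ : ∃ a, a = e.coord 0 (X (1, 0)) := ⟨_, rfl⟩
  obtain ⟨l₁₂, h12⟩ : ∃ a, a = e.coord 0 (X (0, 1)) := ⟨_, rfl⟩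
  obtain ⟨l₂₁, h21⟩ : ∃ a, a = e.coord 1 (X (1, 0)) := ⟨_, rfl⟩
  obtain ⟨l₂₂, h22⟩ : ∃ a, a = e.coord 1 (X (0, 1)) := ⟨_, rfl⟩
  have hl0 := hlin 0
  have hl1 := hlin 1
  rw [← h11, ← h12] at hl0
  rw [← h21, ← h22] at hl1
  -- A singular matrix would have a kernel vector. Since the third coordinate vanishes on the image
  -- of X, this would contradict injectivity.
  have hdet : l₁₁ * l₂₂ - l₁₂ * l₂₁ ≠ 0 := by
    intro hd
    obtain ⟨a1, a2⟩ := hz l₁₂ (-l₁₁) (by rw [hl0]; ring) (by rw [hl1]; linear_combination -hd)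
    obtain ⟨a3, a4⟩ := hz l₂₂ (-l₂₁) (by rw [hl0]; linear_combination hd) (by rw [hl1]; ring)
    have a5 : l₁₁ = 0 := by linarith
    have a6 : l₂₁ = 0 := by linarith
    obtain ⟨a7, -⟩ := hz 1 0 (by rw [hl0, a5]; ring) (by rw [hl1, a6]; ring)
    exact one_ne_zero a7
  have hc : e.coord 2 b ≠ 0 := by
    intro hc
    have h20 := h2 (1, 0)
    rw [hc, zero_mul, ← h11, ← h21] at h20
    have a5 : l₁₁ = 0 := by nlinarith [sq_nonneg l₁₁, sq_nonneg l₂₁]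
    have a6 : l₂₁ = 0 := by nlinarith [sq_nonneg l₁₁, sq_nonneg l₂₁]
    exact hdet (by rw [a5, a6]; ring)
  obtain ⟨m₁, hm₁⟩ : ∃ a, a = e.coord 0 b := ⟨_, rfl⟩
  obtain ⟨m₂, hm₂⟩ : ∃ a, a = e.coord 1 b := ⟨_, rfl⟩
  -- Cramer's rule: the tangential part of b is a combination of the two columns of L.
  have hα : m₁ = l₁₁ * ((l₂₂ * m₁ - l₁₂ * m₂) / (l₁₁ * l₂₂ - l₁₂ * l₂₁))
      + l₁₂ * ((l₁₁ * m₂ - l₂₁ * m₁) / (l₁₁ * l₂₂ - l₁₂ * l₂₁)) := by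
    rw [← mul_div_assoc, ← mul_div_assoc, ← add_div, eq_div_iff hdet]; ring
  have hβ : m₂ = l₂₁ * ((l₂₂ * m₁ - l₁₂ * m₂) / (l₁₁ * l₂₂ - l₁₂ * l₂₁))
      + l₂₂ * ((l₁₁ * m₂ - l₂₁ * m₁) / (l₁₁ * l₂₂ - l₁₂ * l₂₁)) := by
    rw [← mul_div_assoc, ← mul_div_assoc, ← add_div, eq_div_iff hdet]; ring
  obtain ⟨r1, r2, r3, r4, r5⟩ := shift_and_scale_eq (j := j) hc hdet hα hβ
    (fun x y => by
      have := h2 (x, y)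
      rw [hl0, hl1] at this
      linear_combination 2 * this)
    (fun x y => by
      have := h3 (x, y)
      rw [hl0, hl1, ← hm₁, ← hm₂] at this
      linear_combination 6 * this)
  rw [r3, r4] at hα hβ
  refine ⟨r1, r2, r5 ▸ hc, r5, coord_ext e ?_ ?_ ?_⟩
  · simp only [map_add, map_smul, smul_eq_mul, coord_basis, ← h11, ← h12, ← hm₁]
    rw [if_neg (by decide)]
    linear_combination hα
  · simp only [map_add, map_smul, smul_eq_mul, coord_basis, ← h21, ← h22, ← hm₂]
    rw [if_neg (by decide)]
    linear_combination hβ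
  · simp only [map_add, map_smul, smul_eq_mul, coord_basis, h1]
    rw [r5]; simp

theorem graphDeriv_injective (e : Module.Basis (Fin 3) ℝ A3) (u : ℝ × ℝ → ℝ) (ξ : ℝ × ℝ) :
    Function.Injective (graphDeriv e u ξ) := by
  intro h k hk
  have h0 := congrArg (e.coord 0) hk
  have h1 := congrArg (e.coord 1) hk
  rw [coord_zero_graphDeriv, coord_zero_graphDeriv] at h0
  rw [coord_one_graphDeriv, coord_one_graphDeriv] at h1
  exact Prod.ext h0 h1

/-- Normalizing frames along a graph are determined by the `3`-jet of the graph, up to the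
symmetries of the standard form. -/
theorem normalForm_on_graph {S : Set A3} {p : A3} {e e' : Module.Basis (Fin 3) ℝ A3}
    {I : Fin 5 → ℝ} {u : ℝ × ℝ → ℝ} (hu : ContDiff ℝ ∞ u) {ξ : ℝ × ℝ}
    (hS : ∀ᶠ η in 𝓝 ξ, graphMap e p u η ∈ S) (h : IsNormalForm S (graphMap e p u ξ) e' I) :
    jetDisc (jet u ξ) ≠ 0 ∧ jet u ξ 0 ≠ 0 ∧ jetScale (jet u ξ) ≠ 0 ∧
    (∀ k, e'.coord 2 (graphDeriv e u ξ k) = 0) ∧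
    (∀ k, e'.coord 0 (graphDeriv e u ξ k) ^ 2 + e'.coord 1 (graphDeriv e u ξ k) ^ 2
      = jetScale (jet u ξ) * jetQuadratic (jet u ξ) k.1 k.2) ∧
    e 2 = jetScale (jet u ξ) • e' 2 + (jetShift₁ (jet u ξ) • graphDeriv e u ξ (1, 0)
      + jetShift₂ (jet u ξ) • graphDeriv e u ξ (0, 1)) := by
  -- Along a line in the parameter plane, the curve on the graph is its tangent line plus w(t) times
  -- e 2, where w is u minus its first order Taylor polynomial.
  have key := fun k : ℝ × ℝ => by
    have hT := taylor_line hu ξ k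
    have hk := dirDeriv_two hu k.1 k.2
    have hk3 := dirDeriv_three hu k.1 k.2
    simp only [Prod.mk.eta] at hk hk3
    rw [hk3, hk] at hT
    have hmem : ∀ᶠ t in 𝓝 (0 : ℝ), graphMap e p u ξ + (t • graphDeriv e u ξ k
        + (u (ξ + t • k) - u ξ - dirDeriv k u ξ * t) • e 2) ∈ S := by
      have hc : Tendsto (fun t : ℝ => ξ + t • k) (𝓝 0) (𝓝 ξ) := by
        have : Continuous fun t : ℝ => ξ + t • k := by fun_prop
        simpa using this.tendsto 0
      filter_upwards [hc.eventually hS] with t ht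
      convert ht using 1
      simp only [graphMap, graphDeriv_apply, Prod.fst_add, Prod.snd_add, Prod.smul_fst,
        Prod.smul_snd, smul_eq_mul]
      module
    exact h.curve_expansion (w₂ := jetQuadratic (jet u ξ) k.1 k.2 / 2)
      (w₃ := jetCubic (jet u ξ) k.1 k.2 / 6)
      (w₄ := dirDeriv k (fun ξ => jetCubic (jet u ξ) k.1 k.2) ξ / 24)
      (hT.congr_left fun t => by ring) hmem
  obtain ⟨r1, r2, r3, r4, r5⟩ := frame_relation (graphDeriv_injective e u ξ)
    (fun k => (key k).1) (fun k => (key k).2.1) (fun k => (key k).2.2.1)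
  refine ⟨r1, r2, r3, fun k => (key k).1, fun k => ?_, r5⟩
  have := (key k).2.1
  rw [r4] at this
  linarith

/-- If a surface in standard form is contained in another one, then so are the tangent planes, and
the forms agree. -/
theorem IsNormalForm.forms_eq {S S' : Set A3} {p : A3} {e e' : Module.Basis (Fin 3) ℝ A3}
    {I I' : Fin 5 → ℝ} (h : IsNormalForm S p e I) (h' : IsNormalForm S' p e' I')
    (hsub : S ⊆ S') {v : A3} (hv : e.coord 2 v = 0) :
    e'.coord 2 v = 0 ∧
    e'.coord 0 v ^ 2 + e'.coord 1 v ^ 2 = e.coord 0 v ^ 2 + e.coord 1 v ^ 2 ∧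
    e'.coord 0 v ^ 3 - 3 * e'.coord 0 v * e'.coord 1 v ^ 2
      = e.coord 0 v ^ 3 - 3 * e.coord 0 v * e.coord 1 v ^ 2 ∧
    quartic I' (e'.coord 0 v) (e'.coord 1 v) = quartic I (e.coord 0 v) (e.coord 1 v) := by
  obtain ⟨u, hu, hS, ho⟩ := h.exists_contDiff
  let X : ℝ × ℝ →L[ℝ] A3 := (ContinuousLinearMap.fst ℝ ℝ ℝ).smulRight (e 0)
    + (ContinuousLinearMap.snd ℝ ℝ ℝ).smulRight (e 1)
  have hXa : ∀ k : ℝ × ℝ, X k = k.1 • e 0 + k.2 • e 1 := fun k => rfl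
  have hX : Function.Injective X := by
    intro k l hkl
    have h0 := congrArg (e.coord 0) hkl
    have h1 := congrArg (e.coord 1) hkl
    simp only [hXa, map_add, map_smul, smul_eq_mul, coord_basis] at h0 h1
    exact Prod.ext (by simpa using h0) (by simpa using h1)
  have key := fun k : ℝ × ℝ => by
    have hmem : ∀ᶠ t in 𝓝 (0 : ℝ), p + (t • X k + u (t • k) • e 2) ∈ S' := by
      have hc : Tendsto (fun t : ℝ => t • k) (𝓝 0) (𝓝 0) := by
        have : Continuous fun t : ℝ => t • k := by fun_prop
        simpa using this.tendsto 0
      filter_upwards [hc.eventually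
        (eventually_graphMap_mem hu (value_zero_of_normal ho) hS)] with t ht
      convert hsub ht using 1
      simp only [graphMap, hXa, Prod.smul_fst, Prod.smul_snd, smul_eq_mul]
      module
    exact h'.curve_expansion (w₂ := (k.1 ^ 2 + k.2 ^ 2) / 2)
      (w₃ := (k.1 ^ 3 - 3 * k.1 * k.2 ^ 2) / 6) (w₄ := quartic I k.1 k.2 / 24)
      ((isLittleO_line ho k).congr_left fun t => by
        simp only [standardJet, quartic, Prod.smul_fst, Prod.smul_snd, smul_eq_mul]; ring) hmem
  -- In the frame e the 3-jet is already standard: its trace vanishes and its scale is 1. Hence e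
  -- and e' have the same third vector, and the expansion of orders two to four loses all mixed
  -- terms.
  have hj2 : ∀ a b, jetQuadratic ![1, 0, 1, 1, 0, -1, 0] a b = a ^ 2 + b ^ 2 := fun a b => by
    simp [jetQuadratic]
  have hj3 : ∀ a b, jetCubic ![1, 0, 1, 1, 0, -1, 0] a b = a ^ 3 - 3 * a * b ^ 2 := fun a b => by
    simp only [jetCubic, Matrix.cons_val]; ring
  obtain ⟨-, -, -, r4, r5⟩ := frame_relation (j := ![1, 0, 1, 1, 0, -1, 0]) hX
    (fun k => (key k).1) (fun k => by rw [hj2]; exact (key k).2.1)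
    (fun k => by rw [hj2, hj3]; exact (key k).2.2.1)
  have t1 : jetTrace₁ ![1, 0, 1, 1, 0, -1, 0] = 0 := by simp [jetTrace₁, jetDisc]
  have t2 : jetTrace₂ ![1, 0, 1, 1, 0, -1, 0] = 0 := by simp [jetTrace₂, jetDisc]
  have s0 : jetScale ![1, 0, 1, 1, 0, -1, 0] = 1 := by simp [jetScale, jetDisc, t1, t2]
  have s1 : jetShift₁ ![1, 0, 1, 1, 0, -1, 0] = 0 := by simp [jetShift₁, t1, t2]
  have s2 : jetShift₂ ![1, 0, 1, 1, 0, -1, 0] = 0 := by simp [jetShift₂, t1, t2]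
  rw [s0, s1, s2, zero_smul, zero_smul, one_smul, add_zero, add_zero] at r5
  have hvX : v = X (e.coord 0 v, e.coord 1 v) := by
    rw [hXa]
    refine coord_ext e ?_ ?_ ?_ <;>
      simp [coord_basis, -Module.Basis.coord_apply, hv]
  have hk := key (e.coord 0 v, e.coord 1 v)
  rw [← hvX, r5] at hk
  simp only [coord_basis, if_neg (show ¬(0 : Fin 3) = 2 by decide),
    if_neg (show ¬(1 : Fin 3) = 2 by decide), if_true] at hk
  obtain ⟨k1, k2, k3, k4⟩ := hk
  refine ⟨k1, ?_, ?_, ?_⟩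
  · linear_combination -2 * k2
  · linear_combination -6 * k3
  · linear_combination -24 * k4

/-! ### The tangent plane -/

theorem graphDeriv_mem_tangentConeAt {S : Set A3} {p : A3} {e : Module.Basis (Fin 3) ℝ A3}
    {u : ℝ × ℝ → ℝ} (hu : ContDiff ℝ ∞ u) {ξ : ℝ × ℝ}
    (hS : ∀ᶠ η in 𝓝 ξ, graphMap e p u η ∈ S) (h : ℝ × ℝ) :
    graphDeriv e u ξ h ∈ tangentConeAt ℝ S (graphMap e p u ξ) := by
  have h1 := ((hasFDerivAt_graphMap e p hu ξ).hasFDerivWithinAt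
    (s := {η | graphMap e p u η ∈ S})).mapsTo_tangent_cone
  rw [tangentConeAt_of_mem_nhds hS] at h1
  refine tangentConeAt_mono ?_ (h1 (mem_univ h))
  rintro _ ⟨η, hη, rfl⟩
  exact hη

/-- The differential of u vanishes at the origin. On S the third coordinate equals u of the first
two, so its derivative is zero on the tangent cone; conversely, the graph parametrization realizes
every vector with third coordinate zero. -/
theorem IsNormalForm.mem_tangentPlane_iff {S : Set A3} {p : A3} {e : Module.Basis (Fin 3) ℝ A3}
    {I : Fin 5 → ℝ} (h : IsNormalForm S p e I) {v : A3} :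
    v ∈ tangentPlane S p ↔ e.coord 2 v = 0 := by
  obtain ⟨u, hu, hS, ho⟩ := h.exists_contDiff
  have hu0 := value_zero_of_normal ho
  have hp := graphMap_zero e p u hu0
  have hmem := eventually_graphMap_mem hu hu0 hS
  -- Comparing the frame with itself along its own graph gives du(0) = 0.
  have hd0 : ∀ k, dirDeriv k u 0 = 0 := fun k => by
    have := (normalForm_on_graph hu hmem (hp.symm ▸ h)).2.2.2.1 k
    rwa [coord_two_graphDeriv] at this
  constructor
  · intro hv
    have hle : tangentPlane S p ≤ LinearMap.ker (e.coord 2) := by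
      refine Submodule.span_le.2 fun w hw => ?_
      let c : Fin 3 → A3 →L[ℝ] ℝ := fun i => (e.coord i).toContinuousLinearMap
      have hc : ∀ i, HasFDerivAt (fun q => e.coord i (q - p)) (c i) p := fun i => by
        have := (c i).hasFDerivAt.comp p ((hasFDerivAt_id p).sub_const p)
        rw [ContinuousLinearMap.comp_id] at this
        exact this
      have hu' : HasFDerivAt u (fderiv ℝ u 0) (e.coord 0 (p - p), e.coord 1 (p - p)) := by
        simp only [sub_self, map_zero]
        exact (hu.differentiable (by simp) 0).hasFDerivAt
      have h1 : HasFDerivAt (fun q => u (e.coord 0 (q - p), e.coord 1 (q - p)))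
          ((fderiv ℝ u 0).comp ((c 0).prod (c 1))) p :=
        hu'.comp (f := fun q => (e.coord 0 (q - p), e.coord 1 (q - p))) p
          ((hc 0).prodMk (hc 1))
      have h2 : HasFDerivWithinAt (fun q => e.coord 2 (q - p))
          ((fderiv ℝ u 0).comp ((c 0).prod (c 1))) S p := by
        refine h1.hasFDerivWithinAt.congr_of_eventuallyEq ?_ (by
        simp only [sub_self, map_zero]; exact hu0.symm)
        filter_upwards [nhdsWithin_le_nhds hS, self_mem_nhdsWithin] with q hq hqS
        exact hq.1 hqS
      have h3 := (hc 2).hasFDerivWithinAt.unique_on h2 hw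
      exact h3.trans (hd0 _)
    exact hle hv
  · intro hv
    have h1 := graphDeriv_mem_tangentConeAt hu hmem (e.coord 0 v, e.coord 1 v)
    rw [hp] at h1
    have h2 : graphDeriv e u 0 (e.coord 0 v, e.coord 1 v) = v := by
      refine coord_ext e ?_ ?_ ?_
      · rw [coord_zero_graphDeriv]
      · rw [coord_one_graphDeriv]
      · rw [coord_two_graphDeriv, hd0, hv]
    rw [h2] at h1
    exact Submodule.subset_span h1

theorem IsNormalForm.tangentPlane_eq {S : Set A3} {p : A3} {e : Module.Basis (Fin 3) ℝ A3}
    {I : Fin 5 → ℝ} (h : IsNormalForm S p e I) :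
    tangentPlane S p = Submodule.span ℝ {e 0, e 1} := by
  ext v
  rw [h.mem_tangentPlane_iff, Submodule.mem_span_pair]
  constructor
  · intro hv
    refine ⟨e.coord 0 v, e.coord 1 v, coord_ext e ?_ ?_ ?_⟩ <;>
      simp [coord_basis, -Module.Basis.coord_apply, hv]
  · rintro ⟨a, b, rfl⟩
    simp [coord_basis, -Module.Basis.coord_apply]

/-- A derivative within S is unique only on the tangent cone, hence by linearity on its span. -/
theorem fderivWithin_eq_on_tangentPlane {S : Set A3} {p : A3} {f : A3 → A3}
    {f' : A3 →L[ℝ] A3} (hf : HasFDerivWithinAt f f' S p) {v : A3} (hv : v ∈ tangentPlane S p) :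
    fderivWithin ℝ f S p v = f' v := by
  have h1 : EqOn (fderivWithin ℝ f S p) f' (tangentConeAt ℝ S p) :=
    hf.differentiableWithinAt.hasFDerivWithinAt.unique_on hf
  exact LinearMap.eqOn_span (f := (fderivWithin ℝ f S p).toLinearMap) (g := f'.toLinearMap) h1 hv

/-! ### Pointwise properties of the forms -/

theorem PreservesStandard.transpose_mul {M : Matrix (Fin 2) (Fin 2) ℝ} (hM : PreservesStandard M) :
    M.transpose * M = 1 := by
  have e1 := (hM 1 0).1
  have e2 := (hM 0 1).1
  have e3 := (hM 1 1).1
  ext i j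
  fin_cases i <;> fin_cases j <;>
    simp [Matrix.mul_apply, Fin.sum_univ_two] <;> linarith

/-- The transpose is the inverse, and the inverse of a symmetry is a symmetry. -/
theorem PreservesStandard.transpose {M : Matrix (Fin 2) (Fin 2) ℝ} (hM : PreservesStandard M) :
    PreservesStandard M.transpose := by
  have h1 : M * M.transpose = 1 := mul_eq_one_comm.1 hM.transpose_mul
  have e : ∀ i j, M i 0 * M j 0 + M i 1 * M j 1 = (1 : Matrix (Fin 2) (Fin 2) ℝ) i j :=
    fun i j => by rw [← h1]; simp [Matrix.mul_apply, Fin.sum_univ_two]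
  have e00 := e 0 0
  have e01 := e 0 1
  have e11 := e 1 1
  simp only [Matrix.one_apply_eq, Matrix.one_apply_ne (show (0 : Fin 2) ≠ 1 by decide)] at e00 e01 e11
  intro x y
  have h2 := hM (M 0 0 * x + M 1 0 * y) (M 0 1 * x + M 1 1 * y)
  have hx : M 0 0 * (M 0 0 * x + M 1 0 * y) + M 0 1 * (M 0 1 * x + M 1 1 * y) = x := by
    linear_combination x * e00 + y * e01
  have hy : M 1 0 * (M 0 0 * x + M 1 0 * y) + M 1 1 * (M 0 1 * x + M 1 1 * y) = y := by
    linear_combination x * e01 + y * e11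
  rw [hx, hy] at h2
  simp only [Matrix.transpose_apply]
  exact ⟨h2.1.symm, h2.2.symm⟩

/-- A symmetry of the standard form maps normalizing frames to normalizing frames. -/
theorem IsNormalForm.exists_of_preservesStandard {S : Set A3} {p : A3}
    {e : Module.Basis (Fin 3) ℝ A3} {I : Fin 5 → ℝ} (h : IsNormalForm S p e I)
    {M : Matrix (Fin 2) (Fin 2) ℝ} (hM : PreservesStandard M) :
    ∃ (e' : Module.Basis (Fin 3) ℝ A3) (I' : Fin 5 → ℝ), IsNormalForm S p e' I' ∧
      (∀ v, e'.coord 0 v = M 0 0 * e.coord 0 v + M 0 1 * e.coord 1 v) ∧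
      (∀ v, e'.coord 1 v = M 1 0 * e.coord 0 v + M 1 1 * e.coord 1 v) := by
  have ht := hM.transpose_mul
  have e1 : ∀ i j, M 0 i * M 0 j + M 1 i * M 1 j = (1 : Matrix (Fin 2) (Fin 2) ℝ) i j :=
    fun i j => by rw [← ht]; simp [Matrix.mul_apply, Fin.sum_univ_two]
  have e2 : ∀ i j, M i 0 * M j 0 + M i 1 * M j 1 = (1 : Matrix (Fin 2) (Fin 2) ℝ) i j :=
    fun i j => by rw [← mul_eq_one_comm.1 ht]; simp [Matrix.mul_apply, Fin.sum_univ_two]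
  have a00 := e1 0 0
  have a01 := e1 0 1
  have a11 := e1 1 1
  have b00 := e2 0 0
  have b01 := e2 0 1
  have b11 := e2 1 1
  simp only [Matrix.one_apply_eq, Matrix.one_apply_ne (show (0 : Fin 2) ≠ 1 by decide)]
    at a00 a01 a11 b00 b01 b11
  let L : (Fin 3 → ℝ) ≃ₗ[ℝ] (Fin 3 → ℝ) :=
    { toFun := fun v => ![M 0 0 * v 0 + M 0 1 * v 1, M 1 0 * v 0 + M 1 1 * v 1, v 2]
      map_add' := fun v w => by
        funext i; fin_cases i <;> simp <;> ring
      map_smul' := fun a v => by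
        funext i; fin_cases i <;> simp <;> ring
      invFun := fun v => ![M 0 0 * v 0 + M 1 0 * v 1, M 0 1 * v 0 + M 1 1 * v 1, v 2]
      left_inv := fun v => by
        funext i
        fin_cases i <;> simp
        · linear_combination v 0 * a00 + v 1 * a01
        · linear_combination v 0 * a01 + v 1 * a11
      right_inv := fun v => by
        funext i
        fin_cases i <;> simp
        · linear_combination v 0 * b00 + v 1 * b01
        · linear_combination v 0 * b01 + v 1 * b11 }
  -- The basis is defined through its coordinates: M acts on the first two, and the third is
  -- unchanged.
  let e' : Module.Basis (Fin 3) ℝ A3 := Module.Basis.ofEquivFun (e.equivFun.trans L)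
  have hc : ∀ i v, e'.coord i v = L (fun i => e.coord i v) i := fun i v => rfl
  have hc0 : ∀ v, e'.coord 0 v = M 0 0 * e.coord 0 v + M 0 1 * e.coord 1 v := fun v => hc 0 v
  have hc1 : ∀ v, e'.coord 1 v = M 1 0 * e.coord 0 v + M 1 1 * e.coord 1 v := fun v => hc 1 v
  have hc2 : ∀ v, e'.coord 2 v = e.coord 2 v := fun v => hc 2 v
  obtain ⟨u, hu, hS, ho⟩ := h.exists_contDiff
  -- The old coordinates are Mᵀ = M⁻¹ applied to the new ones. Thus u and its quartic are composed
  -- with Mᵀ.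
  obtain ⟨I', hI'⟩ := exists_quartic_comp I (M 0 0) (M 1 0) (M 0 1) (M 1 1)
  let T : ℝ × ℝ → ℝ × ℝ := fun t => (M 0 0 * t.1 + M 1 0 * t.2, M 0 1 * t.1 + M 1 1 * t.2)
  have hT : ContDiff ℝ ∞ T := by fun_prop
  have hTO : T =O[𝓝 0] (fun t : ℝ × ℝ => t) := by
    have h1 : (fun t : ℝ × ℝ => t.1) =O[𝓝 0] (fun t : ℝ × ℝ => t) := isBigO_fst_prod'
    have h2 : (fun t : ℝ × ℝ => t.2) =O[𝓝 0] (fun t : ℝ × ℝ => t) := isBigO_snd_prod'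
    exact ((h1.const_mul_left _).add (h2.const_mul_left _)).prod_left
      ((h1.const_mul_left _).add (h2.const_mul_left _))
  refine ⟨e', I', ⟨fun t => u (T t), ⟨univ, univ_mem, (hu.comp hT).contDiffOn⟩, ?_, ?_⟩, hc0, hc1⟩
  · filter_upwards [hS] with q hq
    rw [hq, hc2, hc0, hc1]
    have : T (M 0 0 * e.coord 0 (q - p) + M 0 1 * e.coord 1 (q - p),
        M 1 0 * e.coord 0 (q - p) + M 1 1 * e.coord 1 (q - p))
        = (e.coord 0 (q - p), e.coord 1 (q - p)) := by
      refine Prod.ext ?_ ?_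
      · show M 0 0 * _ + M 1 0 * _ = _
        linear_combination e.coord 0 (q - p) * a00 + e.coord 1 (q - p) * a01
      · show M 0 1 * _ + M 1 1 * _ = _
        linear_combination e.coord 0 (q - p) * a01 + e.coord 1 (q - p) * a11
    rw [this]
  · have h1 := (ho.comp_tendsto (hTO.trans_tendsto tendsto_id)).trans_isBigO (hTO.norm_norm.pow 4)
    refine h1.congr_left fun t => ?_
    have h2 := hM.transpose t.1 t.2
    simp only [Matrix.transpose_apply] at h2
    simp only [Function.comp, T, standardJet, hI', ← h2.1]
    rw [show t.1 ^ 3 - 3 * t.1 * t.2 ^ 2 = _ from h2.2.symm]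

theorem IsRegularElliptical.isNormalForm {S : Set A3} (hS : IsRegularElliptical S) (p : S) :
    IsNormalForm S p (hS.frame p) (hS.curvature p) :=
  (hS p p.2).choose_spec.choose_spec

theorem coframe_zero_apply {S : Set A3} {p : A3} (e : Module.Basis (Fin 3) ℝ A3)
    (v : tangentPlane S p) : coframe S p e 0 v = e.coord 0 v := rfl

theorem coframe_one_apply {S : Set A3} {p : A3} (e : Module.Basis (Fin 3) ℝ A3)
    (v : tangentPlane S p) : coframe S p e 1 v = e.coord 1 v := rfl

section
variable {S : Set A3} (hS : IsRegularElliptical S) (p : S) {e : Module.Basis (Fin 3) ℝ A3}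
  {I : Fin 5 → ℝ}

/-- Independence of the chosen frame is the comparison of two normal forms of the same surface. -/
theorem solvesForms_coframe (h : IsNormalForm S p e I) : SolvesForms hS p (coframe S p e) :=
  fun v =>
    have key := (hS.isNormalForm p).forms_eq h subset_rfl
      ((hS.isNormalForm p).mem_tangentPlane_iff.1 v.2)
    ⟨key.2.1, key.2.2.1⟩

theorem form4_eq (h : IsNormalForm S p e I) (v : tangentPlane S p) :
    hS.form4 p v = quartic I (coframe S p e 0 v) (coframe S p e 1 v) :=
  ((hS.isNormalForm p).forms_eq h subset_rfl
    ((hS.isNormalForm p).mem_tangentPlane_iff.1 v.2)).2.2.2.symm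

theorem IsNormalForm.exists_tangent (h : IsNormalForm S p e I) (x y : ℝ) :
    ∃ v : tangentPlane S p, coframe S p e 0 v = x ∧ coframe S p e 1 v = y := by
  refine ⟨⟨x • e 0 + y • e 1, h.mem_tangentPlane_iff.2 ?_⟩, ?_, ?_⟩
  · simp [coord_basis, -Module.Basis.coord_apply]
  · rw [coframe_zero_apply]; simp [coord_basis, -Module.Basis.coord_apply]
  · rw [coframe_one_apply]; simp [coord_basis, -Module.Basis.coord_apply]

theorem form4_eq_iff (h : IsNormalForm S p e I) (J : Fin 5 → ℝ) :
    (∀ v, hS.form4 p v = quartic J (coframe S p e 0 v) (coframe S p e 1 v)) ↔ J = I := by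
  constructor
  · intro hJ
    refine quartic_injective fun x y => ?_
    obtain ⟨v, rfl, rfl⟩ := h.exists_tangent p x y
    rw [← hJ, form4_eq hS p h]
  · rintro rfl v
    exact form4_eq hS p h v

/-- The coframe is a basis of the dual plane and takes all values (x, y). So α = M w for some matrix
M, and the two equations say exactly that M preserves the standard forms. -/
theorem solvesForms_iff (h : IsNormalForm S p e I)
    (α : Fin 2 → Module.Dual ℝ (tangentPlane S p)) :
    SolvesForms hS p α ↔ ∃ M ∈ D3, ∀ i, α i = ∑ j, M i j • coframe S p e j := by
  have hco := solvesForms_coframe hS p h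
  constructor
  · intro hα
    obtain ⟨v₀, hv₀₀, hv₀₁⟩ := h.exists_tangent p 1 0
    obtain ⟨v₁, hv₁₀, hv₁₁⟩ := h.exists_tangent p 0 1
    have hv : ∀ v : tangentPlane S p, v = coframe S p e 0 v • v₀ + coframe S p e 1 v • v₁ := by
      intro v
      refine Subtype.ext (coord_ext e ?_ ?_ ?_)
      · simp only [← coframe_zero_apply, map_add, map_smul, hv₀₀, hv₁₀, smul_eq_mul]; ring
      · simp only [← coframe_one_apply, map_add, map_smul, hv₀₁, hv₁₁, smul_eq_mul]; ring
      · rw [h.mem_tangentPlane_iff.1 v.2, h.mem_tangentPlane_iff.1 (Subtype.prop _)]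
    have hexp : ∀ i v, α i v = α i v₀ * coframe S p e 0 v + α i v₁ * coframe S p e 1 v := by
      intro i v
      conv_lhs => rw [hv v]
      rw [map_add, map_smul, map_smul, smul_eq_mul, smul_eq_mul, mul_comm, mul_comm (coframe S p e 1 v)]
    refine ⟨Matrix.of fun i j => α i (![v₀, v₁] j), mem_D3_iff.2 fun x y => ?_, fun i => ?_⟩
    · obtain ⟨v, rfl, rfl⟩ := h.exists_tangent p x y
      have h1 := hα v
      have h2 := hco v
      rw [← h2.1, ← h2.2, hexp 0 v, hexp 1 v] at h1
      exact h1
    · refine LinearMap.ext fun v => ?_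
      rw [hexp]
      simp [Fin.sum_univ_two]
  · rintro ⟨M, hM, hα⟩ v
    have h1 := mem_D3_iff.1 hM (coframe S p e 0 v) (coframe S p e 1 v)
    rw [(hco v).1, (hco v).2] at h1
    rw [hα 0, hα 1]
    simpa [Fin.sum_univ_two] using h1

theorem solvesForms_iff_exists_coframe (h : IsNormalForm S p e I)
    (α : Fin 2 → Module.Dual ℝ (tangentPlane S p)) :
    SolvesForms hS p α ↔ ∃ (e' : Module.Basis (Fin 3) ℝ A3) (I' : Fin 5 → ℝ),
      IsNormalForm S p e' I' ∧ coframe S p e' = α := by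
  constructor
  · intro hα
    obtain ⟨M, hM, hMα⟩ := (solvesForms_iff hS p h α).1 hα
    obtain ⟨e', I', h', h0, h1⟩ := h.exists_of_preservesStandard (mem_D3_iff.1 hM)
    refine ⟨e', I', h', funext fun i => LinearMap.ext fun v => ?_⟩
    rw [hMα i]
    fin_cases i
    · rw [Fin.sum_univ_two]; exact h0 v
    · rw [Fin.sum_univ_two]; exact h1 v
  · rintro ⟨e', I', h', rfl⟩
    exact solvesForms_coframe hS p h'

end

/-! ### Affine invariance -/

theorem map_coord (e : Module.Basis (Fin 3) ℝ A3) (L : A3 ≃ₗ[ℝ] A3) (i : Fin 3) (v : A3) :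
    (e.map L).coord i (L v) = e.coord i v := by simp

/-- Coordinates with respect to the transported frame are unchanged, so the same u serves. -/
theorem IsNormalForm.image {S : Set A3} {p : A3} {e : Module.Basis (Fin 3) ℝ A3} {I : Fin 5 → ℝ}
    (h : IsNormalForm S p e I) (A : A3 ≃ᵃ[ℝ] A3) :
    IsNormalForm (A '' S) (A p) (e.map A.linear) I := by
  obtain ⟨u, hu, hS, ho⟩ := h
  refine ⟨u, hu, ?_, ho⟩
  have hc : Tendsto A.symm (𝓝 (A p)) (𝓝 p) := by
    have := (A.symm.toAffineMap.continuous_of_finiteDimensional).tendsto (A p)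
    simpa using this
  filter_upwards [hc.eventually hS] with q hq
  obtain ⟨r, rfl⟩ := A.surjective q
  rw [AffineEquiv.symm_apply_apply] at hq
  have hsub : A r - A p = A.linear (r - p) := (A.toAffineMap.linearMap_vsub r p).symm
  rw [hsub, map_coord, map_coord, map_coord, ← hq]
  exact A.injective.mem_set_image

theorem preservesForms_of_affine {S S' : Set A3} (hS : IsRegularElliptical S)
    (hS' : IsRegularElliptical S') {f : A3 → A3} (hf : ContDiffOn ℝ ∞ f S) (hm : MapsTo f S S')
    {A : A3 ≃ᵃ[ℝ] A3} (hA : EqOn f A S) : PreservesForms hS hS' hf hm := by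
  intro p v
  have hsub : A '' S ⊆ S' := by
    rintro _ ⟨q, hq, rfl⟩
    rw [← hA hq]; exact hm hq
  have hd : HasFDerivAt A (A.linear : A3 →ₗ[ℝ] A3).toContinuousLinearMap (p : A3) := by
    have h1 : (fun q => A q) = fun q => A.linear (q - p) + A p := by
      funext q
      have : A.linear (q - p) = A q - A p := A.toAffineMap.linearMap_vsub q p
      rw [this]; abel
    have h2 := ((A.linear : A3 →ₗ[ℝ] A3).toContinuousLinearMap.hasFDerivAt.comp (p : A3)
      ((hasFDerivAt_id (p : A3)).sub_const (p : A3))).add_const (A p)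
    rw [ContinuousLinearMap.comp_id] at h2
    change HasFDerivAt (fun q => A q) _ _
    rw [h1]
    exact h2
  have hval : ((differential hf hm p v : tangentPlane S' (f p)) : A3) = A.linear v :=
    fderivWithin_eq_on_tangentPlane (hd.hasFDerivWithinAt.congr hA (hA p.2)) v.2
  have hn := (hS.isNormalForm p).image A
  rw [← hA p.2] at hn
  have hv := (hS.isNormalForm p).mem_tangentPlane_iff.1 v.2
  -- The image of S need only lie in S', which is why `IsNormalForm.forms_eq` is available for
  -- inclusions.
  have key := hn.forms_eq (hS'.isNormalForm ⟨f p, hm p.2⟩) hsub (v := A.linear v)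
    (by rw [map_coord, hv])
  simp only [map_coord] at key
  rw [← hval] at key
  exact key.2

/-! ### Matched frames -/

/-- The frames `e` of `S` at `p` and `e'` of `S'` at `f p` are normalizing frames with the same
curvatures, and the differential of `f` pulls the coframe of `e'` back to that of `e`. -/
def IsMatched (S S' : Set A3) (f : A3 → A3) (p : A3) (e e' : Module.Basis (Fin 3) ℝ A3)
    (I : Fin 5 → ℝ) : Prop :=
  IsNormalForm S p e I ∧ IsNormalForm S' (f p) e' I ∧
    ∀ v ∈ tangentPlane S p, e'.coord 0 (fderivWithin ℝ f S p v) = e.coord 0 v ∧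
      e'.coord 1 (fderivWithin ℝ f S p v) = e.coord 1 v

/-- The pulled back coframe solves the equations for Φ₂ and Φ₃, so it belongs to a normalizing frame
at p. The quartic representing Φ₄ in this coframe is unique, so the curvatures agree. -/
theorem exists_isMatched {S S' : Set A3} {hS : IsRegularElliptical S}
    {hS' : IsRegularElliptical S'} {f : A3 → A3} {hf : ContDiffOn ℝ ∞ f S} {hm : MapsTo f S S'}
    (h : PreservesForms hS hS' hf hm) (p : S) :
    ∃ e e' I, IsMatched S S' f p e e' I := by
  have hsol : SolvesForms hS p
      ![(coframe S' (f p) (hS'.frame ⟨f p, hm p.2⟩) 0).comp (differential hf hm p),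
        (coframe S' (f p) (hS'.frame ⟨f p, hm p.2⟩) 1).comp (differential hf hm p)] :=
    fun v => ⟨(h p v).1, (h p v).2.1⟩
  obtain ⟨e, I, he, hco⟩ :=
    (solvesForms_iff_exists_coframe hS p (hS.isNormalForm p) _).1 hsol
  have h0 := fun v => LinearMap.congr_fun (congrFun hco 0) v
  have h1 := fun v => LinearMap.congr_fun (congrFun hco 1) v
  have hI : hS'.curvature ⟨f p, hm p.2⟩ = I := by
    refine (form4_eq_iff hS p he _).1 fun v => ?_
    rw [h0, h1]
    exact (h p v).2.2.symm
  exact ⟨e, hS'.frame ⟨f p, hm p.2⟩, I, he, hI ▸ hS'.isNormalForm ⟨f p, hm p.2⟩,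
    fun v hv => ⟨(h0 ⟨v, hv⟩).symm, (h1 ⟨v, hv⟩).symm⟩⟩

/-- The linear map that maps the frame `e` to the frame `e'`. -/
def frameMap (e e' : Module.Basis (Fin 3) ℝ A3) : A3 ≃ₗ[ℝ] A3 := e.equiv e' (Equiv.refl _)

theorem frameMap_apply_basis (e e' : Module.Basis (Fin 3) ℝ A3) (i : Fin 3) :
    frameMap e e' (e i) = e' i := by simp [frameMap]

theorem coord_frameMap (e e' : Module.Basis (Fin 3) ℝ A3) (i : Fin 3) (v : A3) :
    e'.coord i (frameMap e e' v) = e.coord i v := by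
  have : (e'.coord i) ∘ₗ (frameMap e e').toLinearMap = e.coord i := by
    refine e.ext fun j => ?_
    simp [frameMap_apply_basis, coord_basis, -Module.Basis.coord_apply]
  exact LinearMap.congr_fun this v

theorem IsMatched.frameMap_apply {S S' : Set A3} {f : A3 → A3} {p : A3}
    {e e' : Module.Basis (Fin 3) ℝ A3} {I : Fin 5 → ℝ} (h : IsMatched S S' f p e e' I)
    (hp : p ∈ S) (hf : ContDiffOn ℝ ∞ f S) (hm : MapsTo f S S') {v : A3}
    (hv : v ∈ tangentPlane S p) : frameMap e e' v = fderivWithin ℝ f S p v := by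
  have h2 := h.2.2 v hv
  refine coord_ext e' ?_ ?_ ?_
  · rw [coord_frameMap, h2.1]
  · rw [coord_frameMap, h2.2]
  · rw [coord_frameMap, h.1.mem_tangentPlane_iff.1 hv]
    exact (h.2.1.mem_tangentPlane_iff.1 (differential hf hm ⟨p, hp⟩ ⟨v, hv⟩).2).symm

/-! ### First order variation of the frames -/

/-- A map of the plane that is isometric to first order has a differential that is constant to
first order. -/
theorem tangentAtZero_fderiv_of_isometric {φ : ℝ × ℝ → ℝ × ℝ} (hφ : ContDiffAt ℝ 2 φ 0)
    (h0 : ∀ k, fderiv ℝ φ 0 k = k) {E F G E' F' G' : ℝ × ℝ → ℝ} (hE : TangentAtZero E E')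
    (hF : TangentAtZero F F') (hG : TangentAtZero G G') (hE0 : E 0 = 1) (hF0 : F 0 = 0)
    (hG0 : G 0 = 1)
    (h : ∀ᶠ ξ in 𝓝 0, ∀ k : ℝ × ℝ,
      E ξ * (k.1 * k.1) + F ξ * (2 * (k.1 * k.2)) + G ξ * (k.2 * k.2)
      = E' ξ * ((fderiv ℝ φ ξ k).1 * (fderiv ℝ φ ξ k).1)
        + F' ξ * (2 * ((fderiv ℝ φ ξ k).1 * (fderiv ℝ φ ξ k).2))
        + G' ξ * ((fderiv ℝ φ ξ k).2 * (fderiv ℝ φ ξ k).2)) (k : ℝ × ℝ) :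
    TangentAtZero (fun ξ => fderiv ℝ φ ξ k) (fun _ => k) := by
  have hD : HasFDerivAt (fderiv ℝ φ) (fderiv ℝ (fderiv ℝ φ) 0) 0 :=
    ((hφ.fderiv_right (m := 1) (by norm_num)).differentiableAt (by simp)).hasFDerivAt
  have hsymm : ∀ a b, fderiv ℝ (fderiv ℝ φ) 0 a b = fderiv ℝ (fderiv ℝ φ) 0 b a :=
    hφ.isSymmSndFDerivAt (by simp)
  set B := fderiv ℝ (fderiv ℝ φ) 0 with hB
  have hk : ∀ k : ℝ × ℝ, HasFDerivAt (fun ξ => fderiv ℝ φ ξ k)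
      ((ContinuousLinearMap.apply ℝ (ℝ × ℝ) k).comp B) 0 := fun k =>
    (ContinuousLinearMap.apply ℝ (ℝ × ℝ) k).hasFDerivAt.comp 0 hD
  obtain ⟨dE, hE1, hE2⟩ := hE.2
  obtain ⟨dF, hF1, hF2⟩ := hF.2
  obtain ⟨dG, hG1, hG2⟩ := hG.2
  -- Differentiate the isometry identity at 0. The derivatives of the coefficients cancel because
  -- the two metrics agree to first order, and ⟨k, B(h, k)⟩ = 0 remains.
  have hskew : ∀ h k : ℝ × ℝ, k.1 * (B h k).1 + k.2 * (B h k).2 = 0 := by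
    intro a k
    have hx := (hk k).fst
    have hy := (hk k).snd
    have hl := ((hE1.mul_const (k.1 * k.1)).add (hF1.mul_const (2 * (k.1 * k.2)))).add
      (hG1.mul_const (k.2 * k.2))
    have hr := ((hE2.mul (hx.mul hx)).add (hF2.mul ((hx.mul hy).const_mul 2))).add
      (hG2.mul (hy.mul hy))
    have := DFunLike.congr_fun (hl.unique (hr.congr_of_eventuallyEq (h.mono fun ξ hξ => hξ k))) a
    simp only [h0, ← hE.1, ← hF.1, ← hG.1, hE0, hF0, hG0, add_apply,
      smul_apply, ContinuousLinearMap.comp_apply, smul_eq_mul,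
      ContinuousLinearMap.coe_fst', ContinuousLinearMap.coe_snd',
      ContinuousLinearMap.apply_apply, Pi.mul_apply] at this
    linear_combination -this / 2
  -- The trilinear form ⟨B(a, k), l⟩ is symmetric in a, k and skew in k, l, so it vanishes.
  have hB0 : ∀ a k, B a k = 0 := by
    have e1 := fun a => hskew a (1, 0)
    have e2 := fun a => hskew a (0, 1)
    have e3 := fun a => hskew a (1, 1)
    have hs : ∀ a : ℝ × ℝ, B a (1, 1) = B a (1, 0) + B a (0, 1) := fun a => by
      rw [← map_add]; simp
    simp only [hs, Prod.fst_add, Prod.snd_add, one_mul, zero_mul, zero_add, add_zero] at e1 e2 e3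
    have s := hsymm (1, 0) (0, 1)
    have f1 := e1 (1, 0)
    have f2 := e1 (0, 1)
    have f3 := e2 (1, 0)
    have f4 := e2 (0, 1)
    have f5 := e3 (1, 0)
    have f6 := e3 (0, 1)
    rw [s] at f5 f3
    have g1 : B (1, 0) (1, 0) = 0 := Prod.ext f1 (by
      simp only [Prod.snd_zero]; linarith)
    have g2 : B (0, 1) (1, 0) = 0 := Prod.ext f2 f3
    have g3 : B (1, 0) (0, 1) = 0 := s.trans g2
    have g4 : B (0, 1) (0, 1) = 0 := Prod.ext (by
      rw [g2] at f6; simp only [Prod.fst_zero, Prod.snd_zero] at f6 ⊢; linarith) f4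
    intro a k
    have ha : a = a.1 • ((1, 0) : ℝ × ℝ) + a.2 • ((0, 1) : ℝ × ℝ) := by simp
    have hk' : k = k.1 • ((1, 0) : ℝ × ℝ) + k.2 • ((0, 1) : ℝ × ℝ) := by simp
    rw [ha, hk']
    simp only [map_add, map_smul, add_apply, smul_apply,
      g1, g2, g3, g4, smul_zero, add_zero]
  have hz : (ContinuousLinearMap.apply ℝ (ℝ × ℝ) k).comp B = 0 :=
    ContinuousLinearMap.ext fun a => hB0 a k
  exact ⟨h0 k, 0, hz ▸ hk k, hasFDerivAt_const k 0⟩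

section
variable {J J' : ℝ × ℝ → Fin 7 → ℝ}

/-- This and the following lemmas use that the normalization data are rational in the 3-jet, with
denominators that do not vanish at the origin. -/
theorem tangentAtZero_jetDisc (h : ∀ i, TangentAtZero (fun ξ => J ξ i) (fun ξ => J' ξ i)) :
    TangentAtZero (fun ξ => jetDisc (J ξ)) (fun ξ => jetDisc (J' ξ)) :=
  ((h 0).mul (h 2)).sub ((h 1).pow 2)

theorem tangentAtZero_jetTrace₁ (h : ∀ i, TangentAtZero (fun ξ => J ξ i) (fun ξ => J' ξ i))
    (hd : jetDisc (J 0) ≠ 0) :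
    TangentAtZero (fun ξ => jetTrace₁ (J ξ)) (fun ξ => jetTrace₁ (J' ξ)) :=
  ((((h 2).mul (h 3)).sub (((h 1).const_mul 2).mul (h 4))).add ((h 0).mul (h 5))).div
    ((tangentAtZero_jetDisc h).const_mul 4) (mul_ne_zero four_ne_zero hd)

theorem tangentAtZero_jetTrace₂ (h : ∀ i, TangentAtZero (fun ξ => J ξ i) (fun ξ => J' ξ i))
    (hd : jetDisc (J 0) ≠ 0) :
    TangentAtZero (fun ξ => jetTrace₂ (J ξ)) (fun ξ => jetTrace₂ (J' ξ)) :=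
  ((((h 2).mul (h 4)).sub (((h 1).const_mul 2).mul (h 5))).add ((h 0).mul (h 6))).div
    ((tangentAtZero_jetDisc h).const_mul 4) (mul_ne_zero four_ne_zero hd)

theorem tangentAtZero_jetShift₁ (h : ∀ i, TangentAtZero (fun ξ => J ξ i) (fun ξ => J' ξ i))
    (hd : jetDisc (J 0) ≠ 0) :
    TangentAtZero (fun ξ => jetShift₁ (J ξ)) (fun ξ => jetShift₁ (J' ξ)) :=
  (((h 2).mul (tangentAtZero_jetTrace₁ h hd)).sub
    ((h 1).mul (tangentAtZero_jetTrace₂ h hd))).div (tangentAtZero_jetDisc h) hd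

theorem tangentAtZero_jetShift₂ (h : ∀ i, TangentAtZero (fun ξ => J ξ i) (fun ξ => J' ξ i))
    (hd : jetDisc (J 0) ≠ 0) :
    TangentAtZero (fun ξ => jetShift₂ (J ξ)) (fun ξ => jetShift₂ (J' ξ)) :=
  (((h 0).mul (tangentAtZero_jetTrace₂ h hd)).sub
    ((h 1).mul (tangentAtZero_jetTrace₁ h hd))).div (tangentAtZero_jetDisc h) hd

theorem tangentAtZero_jetScale (h : ∀ i, TangentAtZero (fun ξ => J ξ i) (fun ξ => J' ξ i))
    (hd : jetDisc (J 0) ≠ 0) (h0 : J 0 0 ≠ 0) :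
    TangentAtZero (fun ξ => jetScale (J ξ)) (fun ξ => jetScale (J' ξ)) := by
  have t1 := tangentAtZero_jetTrace₁ h hd
  have t2 := tangentAtZero_jetTrace₂ h hd
  exact (((((h 4).sub (((t1.const_mul 2).mul (h 1)).add (t2.mul (h 0)))).pow 2).sub
    (((h 3).sub ((t1.const_mul 3).mul (h 0))).mul
      ((h 5).sub ((t1.mul (h 2)).add ((t2.const_mul 2).mul (h 1))))))).div
    ((tangentAtZero_jetDisc h).mul (h 0)) (mul_ne_zero hd h0)

end

/-! ### Constancy of the affine map between matched frames -/

theorem graphDeriv_eq (e : Module.Basis (Fin 3) ℝ A3) (u : ℝ × ℝ → ℝ) (ξ k : ℝ × ℝ) :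
    graphDeriv e u ξ k = k.1 • graphDeriv e u ξ (1, 0) + k.2 • graphDeriv e u ξ (0, 1) := by
  rw [← map_smul, ← map_smul, ← map_add]
  simp

/-- A map that preserves the forms, in the coordinates of a pair of graphs. -/
theorem exists_coordinate_expression {S S' : Set A3} {f : A3 → A3} (hf : ContDiffOn ℝ ∞ f S)
    (hm : MapsTo f S S') {p : A3} (hp : p ∈ S) {e e' : Module.Basis (Fin 3) ℝ A3}
    {u u' : ℝ × ℝ → ℝ} (hu : ContDiff ℝ ∞ u) (hu' : ContDiff ℝ ∞ u') (hu0 : u 0 = 0)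
    (hS : ∀ᶠ ξ in 𝓝 0, graphMap e p u ξ ∈ S)
    (hS' : ∀ᶠ q in 𝓝 (f p), (q ∈ S' ↔ e'.coord 2 (q - f p)
      = u' (e'.coord 0 (q - f p), e'.coord 1 (q - f p)))) :
    ∃ φ : ℝ × ℝ → ℝ × ℝ, ContDiffAt ℝ ∞ φ 0 ∧ φ 0 = 0 ∧
      ∀ᶠ ξ in 𝓝 0, f (graphMap e p u ξ) = graphMap e' (f p) u' (φ ξ) ∧
        ∀ k, fderivWithin ℝ f S (graphMap e p u ξ) (graphDeriv e u ξ k)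
          = graphDeriv e' u' (φ ξ) (fderiv ℝ φ ξ k) := by
  have hX0 := graphMap_zero e p u hu0
  have hY : ContDiffAt ℝ ∞ (fun ξ => f (graphMap e p u ξ)) 0 := by
    have h1 : ContDiffWithinAt ℝ ∞ f S (graphMap e p u 0) := by rw [hX0]; exact hf p hp
    have h2 := h1.comp_of_preimage_mem_nhdsWithin (s := univ) 0
      (contDiff_graphMap e p hu).contDiffAt.contDiffWithinAt (by rwa [nhdsWithin_univ])
    rwa [contDiffWithinAt_univ] at h2
  let c : Fin 3 → A3 →L[ℝ] ℝ := fun i => (e'.coord i).toContinuousLinearMap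
  let φ : ℝ × ℝ → ℝ × ℝ := fun ξ =>
    (c 0 (f (graphMap e p u ξ) - f p), c 1 (f (graphMap e p u ξ) - f p))
  have hφ : ContDiffAt ℝ ∞ φ 0 :=
    ((c 0).contDiff.contDiffAt.comp 0 (hY.sub contDiffAt_const)).prodMk
      ((c 1).contDiff.contDiffAt.comp 0 (hY.sub contDiffAt_const))
  have heq : ∀ᶠ ξ in 𝓝 0, f (graphMap e p u ξ) = graphMap e' (f p) u' (φ ξ) := by
    have hc := hY.continuousAt.tendsto
    rw [hX0] at hc
    filter_upwards [hc.eventually (eventually_eq_graphMap hS'), hS] with ξ h1 h2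
    exact h1 (hm h2)
  have hφd : ∀ᶠ ξ in 𝓝 0, DifferentiableAt ℝ φ ξ :=
    ((hφ.of_le (natCast_le_infty 1)).eventually (by simp)).mono fun ξ h =>
      h.differentiableAt (by simp)
  refine ⟨φ, hφ, by simp [φ, hX0], ?_⟩
  filter_upwards [heq, heq.eventually_nhds, hφd, hS, hS.eventually_nhds] with ξ h1 h2 h3 h4 h5
  refine ⟨h1, fun k => ?_⟩
  have h6 : HasFDerivAt (fun ξ => f (graphMap e p u ξ))
      ((fderivWithin ℝ f S (graphMap e p u ξ)).comp (graphDeriv e u ξ)) ξ :=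
    ((hf.differentiableOn (by simp)) _ h4).hasFDerivWithinAt.comp_hasFDerivAt ξ
      (hasFDerivAt_graphMap e p hu ξ) h5
  have h7 : HasFDerivAt (fun ξ => graphMap e' (f p) u' (φ ξ))
      ((graphDeriv e' u' (φ ξ)).comp (fderiv ℝ φ ξ)) ξ :=
    (hasFDerivAt_graphMap e' (f p) hu' (φ ξ)).comp ξ h3.hasFDerivAt
  exact DFunLike.congr_fun (h6.unique (h7.congr_of_eventuallyEq h2)) k

/-- The linear maps between matched frames are constant to first order. -/
theorem hasFDerivWithinAt_frameMap {S S' : Set A3} {f : A3 → A3} (hf : ContDiffOn ℝ ∞ f S)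
    (hm : MapsTo f S S') {e e' : A3 → Module.Basis (Fin 3) ℝ A3} {I : A3 → Fin 5 → ℝ}
    (h : ∀ p ∈ S, IsMatched S S' f p (e p) (e' p) (I p)) {p : A3} (hp : p ∈ S) (v : A3) :
    HasFDerivWithinAt (fun q => frameMap (e q) (e' q) v) (0 : A3 →L[ℝ] A3) S p := by
  obtain ⟨u, hu, hgS, ho⟩ := (h p hp).1.exists_contDiff
  obtain ⟨u', hu', hgS', ho'⟩ := (h p hp).2.1.exists_contDiff
  have hu0 := value_zero_of_normal ho
  have hu0' := value_zero_of_normal ho'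
  have hS := eventually_graphMap_mem hu hu0 hgS
  have hS' := eventually_graphMap_mem hu' hu0' hgS'
  have hX0 := graphMap_zero (e p) p u hu0
  have hX0' := graphMap_zero (e' p) (f p) u' hu0'
  obtain ⟨φ, hφ, hφ0, hfφ⟩ := exists_coordinate_expression hf hm hp hu hu' hu0 hS hgS'
  -- Equal curvatures make the two standard jets cancel. This is where Φ₄ enters: it gives the first
  -- derivatives of the third order part of the jet.
  have hoo : (fun ξ => u ξ - u' ξ) =o[𝓝 0] (fun x : ℝ × ℝ => ‖x‖ ^ 4) :=
    (ho.sub ho').congr_left fun t => by ring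
  obtain ⟨hd1, hj⟩ := tangentAtZero_derivatives hu hu' hoo
  -- the differential of the coordinate expression at the origin
  have hφid : ∀ k, fderiv ℝ φ 0 k = k := by
    intro k
    have h1 := hfφ.self_of_nhds.2 k
    rw [hφ0] at h1
    have h2 := graphDeriv_mem_tangentConeAt (e := e p) hu hS k
    rw [hX0] at h1 h2
    have h3 := (h p hp).2.2 _ (Submodule.subset_span h2)
    rw [h1, coord_zero_graphDeriv, coord_zero_graphDeriv, coord_one_graphDeriv,
      coord_one_graphDeriv] at h3
    exact Prod.ext h3.1 h3.2
  have hφd : HasFDerivAt φ (ContinuousLinearMap.id ℝ (ℝ × ℝ)) 0 := by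
    have h1 := (hφ.differentiableAt (by simp)).hasFDerivAt
    have h2 : fderiv ℝ φ 0 = ContinuousLinearMap.id ℝ (ℝ × ℝ) := ContinuousLinearMap.ext hφid
    rwa [h2] at h1
  have hj' : ∀ i, TangentAtZero (fun ξ => jet u ξ i) (fun ξ => jet u' (φ ξ) i) := fun i =>
    (hj i).comp_right hφ0 hφd
  obtain ⟨hdisc, hr, hscale, -, hmet, -⟩ := normalForm_on_graph hu hS
    (by rw [hX0]; exact (h p hp).1)
  have tscale := tangentAtZero_jetScale hj' hdisc hr
  have tshift₁ := tangentAtZero_jetShift₁ hj' hdisc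
  have tshift₂ := tangentAtZero_jetShift₂ hj' hdisc
  -- the relations along the graph
  have hloc : ∀ᶠ ξ in 𝓝 0,
      (∀ k, jetScale (jet u ξ) * jetQuadratic (jet u ξ) k.1 k.2
        = jetScale (jet u' (φ ξ)) * jetQuadratic (jet u' (φ ξ)) (fderiv ℝ φ ξ k).1
          (fderiv ℝ φ ξ k).2) ∧
      (∀ k, frameMap (e (graphMap (e p) p u ξ)) (e' (graphMap (e p) p u ξ))
        (graphDeriv (e p) u ξ k) = graphDeriv (e' p) u' (φ ξ) (fderiv ℝ φ ξ k)) ∧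
      frameMap (e (graphMap (e p) p u ξ)) (e' (graphMap (e p) p u ξ)) (e p 2)
        = jetScale (jet u ξ) • ((jetScale (jet u' (φ ξ)))⁻¹ • (e' p 2
          - (jetShift₁ (jet u' (φ ξ)) • graphDeriv (e' p) u' (φ ξ) (1, 0)
            + jetShift₂ (jet u' (φ ξ)) • graphDeriv (e' p) u' (φ ξ) (0, 1))))
          + (jetShift₁ (jet u ξ) • graphDeriv (e' p) u' (φ ξ) (fderiv ℝ φ ξ (1, 0))
            + jetShift₂ (jet u ξ) • graphDeriv (e' p) u' (φ ξ) (fderiv ℝ φ ξ (0, 1))) := by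
    have hφc : Tendsto φ (𝓝 0) (𝓝 0) := by
      have := hφ.continuousAt.tendsto
      rwa [hφ0] at this
    filter_upwards [hfφ, hS, hS.eventually_nhds, hφc.eventually hS'.eventually_nhds]
      with ξ h1 h2 h3 h4
    obtain ⟨q, hq⟩ : ∃ q, q = graphMap (e p) p u ξ := ⟨_, rfl⟩
    have hM := h _ h2
    have hn := hM.2.1
    rw [h1.1] at hn
    obtain ⟨-, -, -, a1, a2, a3⟩ := normalForm_on_graph hu h3 hM.1
    obtain ⟨-, -, b0, b1, b2, b3⟩ := normalForm_on_graph hu' h4 hn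
    have htan : ∀ k, graphDeriv (e p) u ξ k ∈ tangentPlane S (graphMap (e p) p u ξ) := fun k =>
      hM.1.mem_tangentPlane_iff.2 (a1 k)
    have hL : ∀ k, frameMap (e (graphMap (e p) p u ξ)) (e' (graphMap (e p) p u ξ))
        (graphDeriv (e p) u ξ k) = graphDeriv (e' p) u' (φ ξ) (fderiv ℝ φ ξ k) := fun k => by
      rw [hM.frameMap_apply h2 hf hm (htan k), h1.2]
    refine ⟨fun k => ?_, hL, ?_⟩
    · have h5 := hM.2.2 _ (htan k)
      rw [h1.2] at h5
      rw [← a2, ← b2, h5.1, h5.2]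
    · have h6 : e' (graphMap (e p) p u ξ) 2 = (jetScale (jet u' (φ ξ)))⁻¹ • (e' p 2
          - (jetShift₁ (jet u' (φ ξ)) • graphDeriv (e' p) u' (φ ξ) (1, 0)
            + jetShift₂ (jet u' (φ ξ)) • graphDeriv (e' p) u' (φ ξ) (0, 1))) := by
        rw [eq_inv_smul_iff₀ b0, eq_sub_iff_add_eq]
        exact b3.symm
      conv_lhs => rw [a3]
      rw [map_add, map_add, map_smul, map_smul, map_smul, frameMap_apply_basis, hL, hL, h6]
  -- the differential of the coordinate expression is constant to first order
  have hP : ∀ k, TangentAtZero (fun ξ => fderiv ℝ φ ξ k) (fun _ => k) := by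
    have hq : ∀ k : ℝ × ℝ, jetScale (jet u 0) * jetQuadratic (jet u 0) k.1 k.2
        = k.1 ^ 2 + k.2 ^ 2 := fun k => by
      have := hmet k
      rw [coord_zero_graphDeriv, coord_one_graphDeriv] at this
      exact this.symm
    have q0 := hq (1, 0)
    have q1 := hq (1, 1)
    have q2 := hq (0, 1)
    simp only [jetQuadratic] at q0 q1 q2
    refine tangentAtZero_fderiv_of_isometric (hφ.of_le (natCast_le_infty 2)) hφid
      (tscale.mul (hj' 0)) (tscale.mul (hj' 1)) (tscale.mul (hj' 2)) (by linarith)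
      (by linarith) (by linarith) ?_
    filter_upwards [hloc] with ξ hξ k
    have := hξ.1 k
    simp only [jetQuadratic] at this
    linear_combination this
  have hu'd : ∀ k, TangentAtZero (fun ξ => graphDeriv (e' p) u' (φ ξ) k)
      (fun ξ => graphDeriv (e' p) u' (φ ξ) k) := fun k => by
    have h1 : Differentiable ℝ (dirDeriv k u') := (contDiff_dirDeriv hu' k).differentiable (by simp)
    have h2 : DifferentiableAt ℝ (fun ξ => dirDeriv k u' (φ ξ)) 0 :=
      (h1 _).comp 0 hφd.differentiableAt
    refine TangentAtZero.refl ?_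
    simp only [graphDeriv_apply]
    exact (differentiableAt_const _).add (h2.smul_const _)
  have hYk : ∀ k, TangentAtZero (fun ξ => graphDeriv (e' p) u' (φ ξ) (fderiv ℝ φ ξ k))
      (fun ξ => graphDeriv (e' p) u' (φ ξ) k) := fun k => by
    obtain ⟨D, h1, h2⟩ := (hP k).2
    have hfst : TangentAtZero (fun ξ => (fderiv ℝ φ ξ k).1) (fun _ => k.1) :=
      ⟨congrArg Prod.fst (hP k).1, _, h1.fst, h2.fst⟩
    have hsnd : TangentAtZero (fun ξ => (fderiv ℝ φ ξ k).2) (fun _ => k.2) :=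
      ⟨congrArg Prod.snd (hP k).1, _, h1.snd, h2.snd⟩
    exact ((hfst.smul (hu'd (1, 0))).add (hsnd.smul (hu'd (0, 1)))).congr
      (Eventually.of_forall fun ξ => graphDeriv_eq _ _ _ _)
      (Eventually.of_forall fun ξ => graphDeriv_eq _ _ _ _)
  have hsne : ∀ᶠ ξ in 𝓝 0, jetScale (jet u ξ) ≠ 0 := by
    obtain ⟨D, h1, -⟩ := tscale.2
    exact h1.continuousAt.eventually_ne hscale
  -- To first order the data of u' ∘ φ may be replaced by those of u, and dφ by the identity. The
  -- scales and shifts then cancel, leaving the constant e' p 2.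
  have t2 : TangentAtZero
      (fun ξ => frameMap (e (graphMap (e p) p u ξ)) (e' (graphMap (e p) p u ξ)) (e p 2))
      (fun _ => e' p 2) := by
    have hs' : jetScale (jet u' (φ 0)) ≠ 0 := fun h0 => hscale (tscale.1.trans h0)
    have ts := (TangentAtZero.refl (F := fun ξ => jetScale (jet u ξ))
      (tscale.2.choose_spec.1.differentiableAt))
    refine ((ts.smul ((tscale.symm.inv hs').smul ((TangentAtZero.const (e' p 2)).sub
      ((tshift₁.symm.smul (hu'd (1, 0))).add (tshift₂.symm.smul (hu'd (0, 1))))))).add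
      (((TangentAtZero.refl tshift₁.2.choose_spec.1.differentiableAt).smul (hYk (1, 0))).add
        ((TangentAtZero.refl tshift₂.2.choose_spec.1.differentiableAt).smul (hYk (0, 1))))).congr
      (hloc.mono fun ξ hξ => hξ.2.2) ?_
    filter_upwards [hsne] with ξ hξ
    rw [smul_inv_smul₀ hξ, sub_add_cancel]
  have t01 : ∀ k : ℝ × ℝ, TangentAtZero
      (fun ξ => frameMap (e (graphMap (e p) p u ξ)) (e' (graphMap (e p) p u ξ))
        (k.1 • e p 0 + k.2 • e p 1)) (fun _ => k.1 • e' p 0 + k.2 • e' p 1) := by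
    intro k
    have hdk : TangentAtZero (dirDeriv k u) (fun ξ => dirDeriv k u' (φ ξ)) :=
      (hd1 k).comp_right hφ0 hφd
    -- A horizontal vector is a tangent vector of the graph minus its e 2 component. The two images
    -- have matching 1-jets with their counterparts on S', where the e' 2 components cancel.
    refine ((hYk k).sub (hdk.smul t2)).congr ?_ (Eventually.of_forall fun ξ => ?_)
    · filter_upwards [hloc] with ξ hξ
      have h1 : k.1 • e p 0 + k.2 • e p 1
          = graphDeriv (e p) u ξ k - dirDeriv k u ξ • e p 2 := by
        rw [graphDeriv_apply, add_sub_cancel_right]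
      rw [h1, map_sub, map_smul, hξ.2.1]
    · change _ = graphDeriv (e' p) u' (φ ξ) k - dirDeriv k u' (φ ξ) • e' p 2
      rw [graphDeriv_apply, add_sub_cancel_right]
  have hv : v = ((e p).coord 0 v • e p 0 + (e p).coord 1 v • e p 1) + (e p).coord 2 v • e p 2 := by
    refine coord_ext (e p) ?_ ?_ ?_ <;> simp [coord_basis, -Module.Basis.coord_apply]
  have hg : HasFDerivAt (fun ξ => frameMap (e (graphMap (e p) p u ξ)) (e' (graphMap (e p) p u ξ)) v)
      (0 : ℝ × ℝ →L[ℝ] A3) 0 := by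
    have := (t01 ((e p).coord 0 v, (e p).coord 1 v)).add
      ((TangentAtZero.const ((e p).coord 2 v)).smul t2)
    refine (this.congr (Eventually.of_forall fun ξ => ?_) EventuallyEq.rfl).hasFDerivAt_zero
    conv_lhs => rw [hv]
    rw [map_add, map_smul]
  let c : Fin 3 → A3 →L[ℝ] ℝ := fun i => ((e p).coord i).toContinuousLinearMap
  have hpr : HasFDerivAt (fun q => ((e p).coord 0 (q - p), (e p).coord 1 (q - p)))
      ((c 0).prod (c 1)) p := by
    have hc : ∀ i, HasFDerivAt (fun q => (e p).coord i (q - p)) (c i) p := fun i => by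
      have := (c i).hasFDerivAt.comp p ((hasFDerivAt_id p).sub_const p)
      rw [ContinuousLinearMap.comp_id] at this
      exact this
    exact (hc 0).prodMk (hc 1)
  have hg' : HasFDerivAt
      (fun ξ => frameMap (e (graphMap (e p) p u ξ)) (e' (graphMap (e p) p u ξ)) v)
      (0 : ℝ × ℝ →L[ℝ] A3) ((e p).coord 0 (p - p), (e p).coord 1 (p - p)) := by
    simp only [sub_self, map_zero]
    exact hg
  have hcomp := (hg'.comp p hpr).hasFDerivWithinAt (s := S)
  rw [ContinuousLinearMap.zero_comp] at hcomp
  refine hcomp.congr_of_eventuallyEq ?_ ?_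
  · filter_upwards [nhdsWithin_le_nhds (eventually_eq_graphMap hgS), self_mem_nhdsWithin]
      with q h1 h2
    simp only [Function.comp]
    rw [← h1 h2]
  · simp only [Function.comp, sub_self, map_zero]
    change _ = frameMap (e (graphMap (e p) p u 0)) (e' (graphMap (e p) p u 0)) v
    rw [hX0]

/-- The affine maps that belong to matched frames are locally constant. -/
theorem eventually_frameMap_eq {S S' : Set A3} {f : A3 → A3} (hf : ContDiffOn ℝ ∞ f S)
    (hm : MapsTo f S S') {e e' : A3 → Module.Basis (Fin 3) ℝ A3} {I : A3 → Fin 5 → ℝ}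
    (h : ∀ p ∈ S, IsMatched S S' f p (e p) (e' p) (I p)) {p : A3} (hp : p ∈ S) :
    ∀ᶠ q in 𝓝[S] p, frameMap (e q) (e' q) = frameMap (e p) (e' p) ∧
      f q - frameMap (e q) (e' q) q = f p - frameMap (e p) (e' p) p := by
  obtain ⟨u, hu, hgS, ho⟩ := (h p hp).1.exists_contDiff
  have hu0 := value_zero_of_normal ho
  have hX0 := graphMap_zero (e p) p u hu0
  obtain ⟨r, hr, hball⟩ := Metric.eventually_nhds_iff_ball.1 (eventually_graphMap_mem hu hu0 hgS)
  have hnhds : ∀ ξ ∈ Metric.ball (0 : ℝ × ℝ) r, ∀ᶠ η in 𝓝 ξ, graphMap (e p) p u η ∈ S :=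
    fun ξ hξ => (Metric.isOpen_ball.eventually_mem hξ).mono hball
  have h0 : (0 : ℝ × ℝ) ∈ Metric.ball (0 : ℝ × ℝ) r := Metric.mem_ball_self hr
  have hconst : ∀ (F : ℝ × ℝ → A3), (∀ ξ ∈ Metric.ball (0 : ℝ × ℝ) r,
      HasFDerivAt F (0 : ℝ × ℝ →L[ℝ] A3) ξ) → ∀ ξ ∈ Metric.ball (0 : ℝ × ℝ) r, F ξ = F 0 := by
    intro F hF ξ hξ
    exact Metric.isOpen_ball.is_const_of_fderiv_eq_zero
      (convex_ball (0 : ℝ × ℝ) r).isPreconnected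
      (fun η hη => (hF η hη).differentiableAt.differentiableWithinAt)
      (fun η hη => (hF η hη).fderiv) hξ h0
  have hL : ∀ ξ ∈ Metric.ball (0 : ℝ × ℝ) r,
      frameMap (e (graphMap (e p) p u ξ)) (e' (graphMap (e p) p u ξ))
        = frameMap (e p) (e' p) := by
    intro ξ hξ
    refine LinearEquiv.ext fun v => ?_
    have := hconst (fun ξ => frameMap (e (graphMap (e p) p u ξ)) (e' (graphMap (e p) p u ξ)) v)
      (fun η hη => by
        have h1 := (hasFDerivWithinAt_frameMap hf hm h (hball η hη) v).comp_hasFDerivAt η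
          (hasFDerivAt_graphMap (e p) p hu η) (hnhds η hη)
        rwa [ContinuousLinearMap.zero_comp] at h1) ξ hξ
    simpa only [hX0] using this
  -- With L constant, f - L has zero differential along the graph, because L extends the
  -- differential of f on each tangent plane.
  have hT : ∀ ξ ∈ Metric.ball (0 : ℝ × ℝ) r,
      f (graphMap (e p) p u ξ) - frameMap (e p) (e' p) (graphMap (e p) p u ξ)
        = f p - frameMap (e p) (e' p) p := by
    intro ξ hξ
    have := hconst (fun ξ => f (graphMap (e p) p u ξ)
        - frameMap (e p) (e' p) (graphMap (e p) p u ξ)) (fun η hη => by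
      have h1 := ((hf.differentiableOn (by simp)) _
        (hball η hη)).hasFDerivWithinAt.comp_hasFDerivAt η
        (hasFDerivAt_graphMap (e p) p hu η) (hnhds η hη)
      have h2 := ((frameMap (e p) (e' p) : A3 →ₗ[ℝ] A3).toContinuousLinearMap.hasFDerivAt
        (x := graphMap (e p) p u η)).comp η (hasFDerivAt_graphMap (e p) p hu η)
      refine (h1.sub h2).congr_fderiv (ContinuousLinearMap.ext fun k => ?_)
      have h3 := (h _ (hball η hη)).frameMap_apply (hball η hη) hf hm (Submodule.subset_span
        (graphDeriv_mem_tangentConeAt hu (hnhds η hη) k))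
      rw [hL η hη] at h3
      exact sub_eq_zero.2 h3.symm) ξ hξ
    simpa only [hX0] using this
  have hpr : Tendsto (fun q => ((e p).coord 0 (q - p), (e p).coord 1 (q - p))) (𝓝 p) (𝓝 0) := by
    have hc : Continuous fun q => ((e p).coord 0 (q - p), (e p).coord 1 (q - p)) :=
      ((continuous_coord (e p) 0).comp (continuous_id.sub continuous_const)).prodMk
        ((continuous_coord (e p) 1).comp (continuous_id.sub continuous_const))
    have := hc.tendsto p
    simp only [sub_self, map_zero] at this
    exact this
  filter_upwards [nhdsWithin_le_nhds (eventually_eq_graphMap hgS), self_mem_nhdsWithin,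
    nhdsWithin_le_nhds (hpr.eventually (Metric.ball_mem_nhds 0 hr))] with q h1 h2 h3
  have h4 := hL _ h3
  have h5 := hT _ h3
  rw [← h1 h2] at h4 h5
  exact ⟨h4, by rw [h4, h5]⟩

/-- The forms determine a connected surface up to the affine group. -/
theorem exists_affineEquiv {S S' : Set A3} {hS : IsRegularElliptical S}
    {hS' : IsRegularElliptical S'} {f : A3 → A3} {hf : ContDiffOn ℝ ∞ f S} {hm : MapsTo f S S'}
    (hc : IsPreconnected S) (h : PreservesForms hS hS' hf hm) :
    ∃ A : A3 ≃ᵃ[ℝ] A3, EqOn f A S := by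
  rcases S.eq_empty_or_nonempty with rfl | ⟨p₀, hp₀⟩
  · exact ⟨AffineEquiv.refl ℝ A3, fun x hx => hx.elim⟩
  have : Nonempty (Module.Basis (Fin 3) ℝ A3) := ⟨Pi.basisFun ℝ (Fin 3)⟩
  -- The matched frames are chosen at each point independently; no regularity in p is required.
  choose! e e' I hM using fun (p : A3) (hp : p ∈ S) => exists_isMatched h ⟨p, hp⟩
  have : PreconnectedSpace S := isPreconnected_iff_preconnectedSpace.1 hc
  have hloc : IsLocallyConstant fun q : S =>
      (frameMap (e q) (e' q), f q - frameMap (e q) (e' q) q) := by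
    refine (IsLocallyConstant.iff_eventually_eq _).2 fun p => ?_
    rw [nhds_subtype_eq_comap_nhdsWithin]
    refine ((eventually_frameMap_eq hf hm hM p.2).comap _).mono fun q hq => ?_
    exact Prod.ext hq.1 hq.2
  refine ⟨(frameMap (e p₀) (e' p₀)).toAffineEquiv.trans
    (AffineEquiv.constVAdd ℝ A3 (f p₀ - frameMap (e p₀) (e' p₀) p₀)), fun q hq => ?_⟩
  have h1 := hloc.apply_eq_of_preconnectedSpace ⟨q, hq⟩ ⟨p₀, hp₀⟩
  have h2 := congrArg Prod.fst h1
  have h3 := congrArg Prod.snd h1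
  simp only at h2 h3
  rw [h2] at h3
  change f q = (f p₀ - frameMap (e p₀) (e' p₀) p₀) + frameMap (e p₀) (e' p₀) q
  rw [← h3]
  abel

end AffineSurface

end

theorem theorem4p3 (S : Set A3) (hS : IsRegularElliptical S) :
    -- at each point: the forms are computed by every normalizing frame, and they determine the
    -- coframe up to the action of `D₃` and then the curvatures
    (∀ (p : S) (e : Module.Basis (Fin 3) ℝ A3) (I : Fin 5 → ℝ), IsNormalForm S p e I →
      tangentPlane S p = Submodule.span ℝ {e 0, e 1} ∧
      SolvesForms hS p (coframe S p e) ∧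
      (∀ α : Fin 2 → Module.Dual ℝ (tangentPlane S p),
        SolvesForms hS p α ↔ ∃ M ∈ D3, ∀ i, α i = ∑ j, M i j • coframe S p e j) ∧
      (∀ α : Fin 2 → Module.Dual ℝ (tangentPlane S p),
        SolvesForms hS p α ↔ ∃ (e' : Module.Basis (Fin 3) ℝ A3) (I' : Fin 5 → ℝ),
          IsNormalForm S p e' I' ∧ coframe S p e' = α) ∧
      (∀ J : Fin 5 → ℝ,
        (∀ v, hS.form4 p v = quartic J (coframe S p e 0 v) (coframe S p e 1 v)) ↔ J = I)) ∧
    -- affine images of regular elliptical surfaces are regular elliptical surfaces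
    (∀ A : A3 ≃ᵃ[ℝ] A3, IsRegularElliptical (A '' S)) ∧
    -- the forms are invariant under the affine group
    (∀ (S' : Set A3) (hS' : IsRegularElliptical S') (f : A3 → A3) (hf : ContDiffOn ℝ ∞ f S)
      (hm : MapsTo f S S'),
      (∃ A : A3 ≃ᵃ[ℝ] A3, EqOn f A S) → PreservesForms hS hS' hf hm) ∧
    -- the forms determine a connected surface up to the affine group
    (IsPreconnected S →
      ∀ (S' : Set A3) (hS' : IsRegularElliptical S') (f : A3 → A3) (hf : ContDiffOn ℝ ∞ f S)
        (hm : MapsTo f S S'),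
        PreservesForms hS hS' hf hm → ∃ A : A3 ≃ᵃ[ℝ] A3, EqOn f A S) := by
  refine ⟨fun p e I h => ⟨h.tangentPlane_eq, solvesForms_coframe hS p h, solvesForms_iff hS p h,
    solvesForms_iff_exists_coframe hS p h, form4_eq_iff hS p h⟩, ?_, ?_, ?_⟩
  · rintro A _ ⟨p, hp, rfl⟩
    exact ⟨_, _, (hS.isNormalForm ⟨p, hp⟩).image A⟩
  · rintro S' hS' f hf hm ⟨A, hA⟩
    exact preservesForms_of_affine hS hS' hf hm hA
  · intro hc S' hS' f hf hm h
    exact exists_affineEquiv hc h
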